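/- Let $G=(V,E,w)$ be a connected, simple, undirected graph with $n$ vertices, $m$ edges and nonnegative real edge weights, let $d(u,v)$ be the shortest-path distance, and let $1\le\rho\le n$. The $\rho$-nearest distance $r_\rho(v)$ is the distance from $v$ to its $\rho$-th closest vertex, $v$ itself being counted; the hop distance $\hat d(u,v)$ is the least number of edges on a shortest (weighted) path from $u$ to $v$; and $\bar r_1(v)=\min\{d(v,x) : \hat d(v,x)>1\}$ (with $\min\emptyset=\infty$). A vertex $v$ has a $(1,\rho)$-ball if $r_\rho(v)\le\bar r_1(v)$. Generating $(1,\rho)$-balls for all vertices means to compute, for every vertex $v$, $\rho$ distinct vertices nearest to $v$ (ties broken arbitrarily) together with their distances from $v$, and $r_\rho(v)$; adding, for every $v$, the shortcut edges from $v$ to these vertices (other than $v$ itself), weighted by the distances, then preserves all distances and yields a graph in which every vertex has a $(1,\rho)$-ball. The machine is a synchronous CRCW PRAM with priority write (among concurrent writes to a cell, the smallest value is stored), with words of $O(\log n)$ bits, and with real numbers that can be copied, added and compared; work is the total number of operations and depth the number of parallel time units. The graph is given by adjacency arrays, in which the edges at a vertex come in arbitrary order. **Lemma.** There is a program that generates $(1,\rho)$-balls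 for all vertices in $O(m\log n+n\rho^2)$ work and $O(\rho^2)$ depth, and there is a program that does so in $O(m\log n+n\rho^2\log(\rho+1))$ work and $O(\rho\log(\rho+1))$ depth. Each program and the constants in its bounds are the same for all $G$ and $\rho$. -/

import Mathlib

/-! ## Weighted graphs, distances, hop distances, radii and balls -/

/-- An undirected simple graph on `n` vertices with nonnegative real edge weights
(the values of `weight` off the edge set play no role). -/
structure WGraph (n : ℕ) where
  graph : SimpleGraph (Fin n)
  weight : Sym2 (Fin n) → ℝ
  weight_nonneg : ∀ e ∈ graph.edgeSet, 0 ≤ weight e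

namespace WGraph

variable {n : ℕ}

/-- Number of edges. -/
noncomputable def numEdges (G : WGraph n) : ℕ := G.graph.edgeSet.ncard

/-- Total weight of a walk. -/
def walkWeight (G : WGraph n) {u v : Fin n} (p : G.graph.Walk u v) : ℝ :=
  (p.edges.map G.weight).sum

/-- Shortest-path distance `d(u,v)` (meaningful for connected graphs). -/
noncomputable def dist (G : WGraph n) (u v : Fin n) : ℝ :=
  ⨅ p : G.graph.Walk u v, G.walkWeight p

theorem walkWeight_nonneg (G : WGraph n) {u v : Fin n} (p : G.graph.Walk u v) :
    0 ≤ G.walkWeight p := by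
  apply List.sum_nonneg
  intro x hx
  obtain ⟨e, he, rfl⟩ := List.mem_map.1 hx
  exact G.weight_nonneg e (p.edges_subset_edgeSet he)

theorem dist_nonneg (G : WGraph n) (u v : Fin n) : 0 ≤ G.dist u v :=
  Real.iInf_nonneg fun p => G.walkWeight_nonneg p

theorem walkWeight_reverse (G : WGraph n) {u v : Fin n} (p : G.graph.Walk u v) :
    G.walkWeight p.reverse = G.walkWeight p := by
  simp [walkWeight, SimpleGraph.Walk.edges_reverse, List.map_reverse, List.sum_reverse]

theorem dist_comm (G : WGraph n) (u v : Fin n) : G.dist u v = G.dist v u := by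
  unfold dist
  refine Equiv.iInf_congr
    ⟨fun p => p.reverse, fun p => p.reverse, fun p => by simp, fun p => by simp⟩ ?_
  intro p
  exact G.walkWeight_reverse p

/-- Hop distance: the least number of edges on a shortest (weighted) path. -/
noncomputable def hopDist (G : WGraph n) (u v : Fin n) : ℕ :=
  sInf {k : ℕ | ∃ p : G.graph.Walk u v, G.walkWeight p = G.dist u v ∧ p.length = k}

/-- `k`-radius: the least distance from `u` to a vertex more than `k` hops away
(`⊤` if there is no such vertex). -/
noncomputable def kRadius (G : WGraph n) (k : ℕ) (u : Fin n) : EReal :=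
  ⨅ v : Fin n, ⨅ _ : k < G.hopDist u v, (G.dist u v : EReal)

/-- Enclosed ball `B(u,r)`. -/
def enclosedBall (G : WGraph n) (u : Fin n) (r : ℝ) : Set (Fin n) := {v | G.dist u v ≤ r}

/-- `ρ`-nearest distance: the distance from `u` to the `ρ`-th closest vertex (`u` itself counts),
that is, the least `r` for which at least `ρ` vertices are within distance `r`. -/
noncomputable def nearestDist (G : WGraph n) (ρ : ℕ) (u : Fin n) : ℝ :=
  sInf {r : ℝ | ρ ≤ (G.enclosedBall u r).ncard}

/-- The vertex `u` has a `(k,ρ)`-ball. -/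
def HasBall (G : WGraph n) (k ρ : ℕ) (u : Fin n) : Prop :=
  (G.nearestDist ρ u : EReal) ≤ G.kRadius k u

/-- `(k,ρ)`-graph: every vertex has a `(k,ρ)`-ball. -/
def IsBallGraph (G : WGraph n) (k ρ : ℕ) : Prop := ∀ u, G.HasBall k ρ u

open Classical in
/-- The graph with a shortcut edge `{u,v}` of weight `d(u,v)` for every `u` and every `v ∈ S u`,
`v ≠ u`; a shortcut replaces a parallel original edge, which is never lighter. -/
noncomputable def withShortcuts (G : WGraph n) (S : Fin n → Set (Fin n)) : WGraph n where
  graph := G.graph ⊔ SimpleGraph.fromRel fun u v => v ∈ S u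
  weight e :=
    if e ∈ (SimpleGraph.fromRel fun u v => v ∈ S u).edgeSet then
      Sym2.lift ⟨fun u v => G.dist u v, fun u v => G.dist_comm u v⟩ e
    else G.weight e
  weight_nonneg := by
    intro e he
    split_ifs with h
    · induction e with
      | h u v => exact G.dist_nonneg u v
    · rw [SimpleGraph.edgeSet_sup] at he
      exact G.weight_nonneg e (he.resolve_right h)

/-- An adjacency-array presentation of `G`: an enumeration of its `2m` arcs (every edge in both
directions), grouped by their tails; the arcs out of one vertex come in an arbitrary order. -/
structure AdjArrays (G : WGraph n) where
  arc : Fin (2 * G.numEdges) ≃ G.graph.Dart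
  mono : Monotone fun e => (arc e).fst

end WGraph

/-! ## A synchronous CRCW PRAM in the work-depth presentation

The shared memory consists of integer arrays and real arrays. Integers are words, bounded in the
course of a run; reals can only be copied, added and compared. A parallel step is carried out
synchronously by processors `0, …, p - 1`: all of them read the memory and evaluate, then the
selected ones write. If several write to one cell in the same step, the smallest of the values
written is stored (priority write). -/

namespace PRAM

/-- Shared memory: `int a i` and `real a i` are the `i`-th cells of the `a`-th arrays. -/
structure Memory where
  int : ℕ → ℕ → ℕ
  real : ℕ → ℕ → ℝ

/-- Word-valued expressions; `pid` is the number of the processor that evaluates. -/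
inductive IExpr where
  | const (k : ℕ)
  | pid
  | read (a : ℕ) (i : IExpr)
  | add (x y : IExpr)
  | sub (x y : IExpr)
  | mul (x y : IExpr)
  | div (x y : IExpr)
  | mod (x y : IExpr)

/-- Real-valued expressions. -/
inductive RExpr where
  | read (a : ℕ) (i : IExpr)
  | add (x y : RExpr)

/-- Tests. -/
inductive BExpr where
  | tt
  | ilt (x y : IExpr)
  | rlt (x y : RExpr)
  | not (b : BExpr)
  | and (b c : BExpr)

/-- Value of a word expression (subtraction is truncated; `x / 0 = 0`, `x mod 0 = x`). -/
def IExpr.eval (s : Memory) (q : ℕ) : IExpr → ℕ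
  | const k => k
  | pid => q
  | read a i => s.int a (i.eval s q)
  | add x y => x.eval s q + y.eval s q
  | sub x y => x.eval s q - y.eval s q
  | mul x y => x.eval s q * y.eval s q
  | div x y => x.eval s q / y.eval s q
  | mod x y => x.eval s q % y.eval s q

noncomputable def RExpr.eval (s : Memory) (q : ℕ) : RExpr → ℝ
  | read a i => s.real a (i.eval s q)
  | add x y => x.eval s q + y.eval s q

def BExpr.eval (s : Memory) (q : ℕ) : BExpr → Prop
  | tt => True
  | ilt x y => x.eval s q < y.eval s q
  | rlt x y => x.eval s q < y.eval s q
  | not b => ¬ b.eval s q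
  | and b c => b.eval s q ∧ c.eval s q

/-- Number of elementary operations that the evaluation of an expression takes. -/
def IExpr.cost : IExpr → ℕ
  | const _ => 1
  | pid => 1
  | read _ i => i.cost + 1
  | add x y => x.cost + y.cost + 1
  | sub x y => x.cost + y.cost + 1
  | mul x y => x.cost + y.cost + 1
  | div x y => x.cost + y.cost + 1
  | mod x y => x.cost + y.cost + 1

def RExpr.cost : RExpr → ℕ
  | read _ i => i.cost + 1
  | add x y => x.cost + y.cost + 1

def BExpr.cost : BExpr → ℕ
  | tt => 1
  | ilt x y => x.cost + y.cost + 1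
  | rlt x y => x.cost + y.cost + 1
  | not b => b.cost + 1
  | and b c => b.cost + c.cost + 1

/-- Programs. `iwrite p b a i x` is the parallel step in which every processor `q < p` for which
the test `b` holds writes the value of `x` to the cell whose index is the value of `i` in the
integer array `a`; `rwrite` does the same for real arrays. -/
inductive Cmd where
  | skip
  | iwrite (p : IExpr) (b : BExpr) (a : ℕ) (i : IExpr) (x : IExpr)
  | rwrite (p : IExpr) (b : BExpr) (a : ℕ) (i : IExpr) (x : RExpr)
  | seq (c d : Cmd)
  | ite (b : BExpr) (c d : Cmd)
  | loop (b : BExpr) (c : Cmd)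

open Classical in
/-- The contents of an array after a concurrent write by the processors `q < p` with `active q`,
where processor `q` writes `val q` to the cell `addr q`. -/
noncomputable def concurrentWrite {α : Type} [LinearOrder α] (p : ℕ) (active : ℕ → Prop)
    (addr : ℕ → ℕ) (val : ℕ → α) (old : ℕ → α) (j : ℕ) : α :=
  if h : ((Finset.range p).filter fun q => active q ∧ addr q = j).Nonempty then
    ((Finset.range p).filter fun q => active q ∧ addr q = j).inf' h val
  else old j

/-- `Exec B c s t w d`: started in memory `s`, the program `c` terminates in memory `t` after
performing `w` operations in total (the work) in `d` time units (the depth), using only processor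
numbers, addresses and stored words up to `B`. Idle processors of a parallel step are charged like
the others. Tests of `ite` and `loop` (a while loop), and numbers of processors, are evaluated by processor
`0`. -/
inductive Exec (B : ℕ) : Cmd → Memory → Memory → ℕ → ℕ → Prop where
  | skip (s : Memory) : Exec B Cmd.skip s s 0 0
  | iwrite (s : Memory) (p : IExpr) (b : BExpr) (a : ℕ) (i x : IExpr)
      (hp : p.eval s 0 ≤ B)
      (hb : ∀ q < p.eval s 0, b.eval s q → i.eval s q ≤ B ∧ x.eval s q ≤ B) :
      Exec B (Cmd.iwrite p b a i x) s
        { s with int := Function.update s.int a (concurrentWrite (p.eval s 0)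
            (fun q => b.eval s q) (fun q => i.eval s q) (fun q => x.eval s q) (s.int a)) }
        (p.cost + p.eval s 0 * (b.cost + i.cost + x.cost + 1))
        (p.cost + (b.cost + i.cost + x.cost + 1))
  | rwrite (s : Memory) (p : IExpr) (b : BExpr) (a : ℕ) (i : IExpr) (x : RExpr)
      (hp : p.eval s 0 ≤ B)
      (hb : ∀ q < p.eval s 0, b.eval s q → i.eval s q ≤ B) :
      Exec B (Cmd.rwrite p b a i x) s
        { s with real := Function.update s.real a (concurrentWrite (p.eval s 0)
            (fun q => b.eval s q) (fun q => i.eval s q) (fun q => x.eval s q) (s.real a)) }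
        (p.cost + p.eval s 0 * (b.cost + i.cost + x.cost + 1))
        (p.cost + (b.cost + i.cost + x.cost + 1))
  | seq (c₁ c₂ : Cmd) (s t u : Memory) (w₁ d₁ w₂ d₂ : ℕ)
      (h₁ : Exec B c₁ s t w₁ d₁) (h₂ : Exec B c₂ t u w₂ d₂) :
      Exec B (Cmd.seq c₁ c₂) s u (w₁ + w₂) (d₁ + d₂)
  | ite_true (b : BExpr) (c₁ c₂ : Cmd) (s t : Memory) (w d : ℕ)
      (hb : b.eval s 0) (h : Exec B c₁ s t w d) :
      Exec B (Cmd.ite b c₁ c₂) s t (b.cost + w) (b.cost + d)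
  | ite_false (b : BExpr) (c₁ c₂ : Cmd) (s t : Memory) (w d : ℕ)
      (hb : ¬ b.eval s 0) (h : Exec B c₂ s t w d) :
      Exec B (Cmd.ite b c₁ c₂) s t (b.cost + w) (b.cost + d)
  | loop_false (b : BExpr) (c : Cmd) (s : Memory) (hb : ¬ b.eval s 0) :
      Exec B (Cmd.loop b c) s s b.cost b.cost
  | loop_true (b : BExpr) (c : Cmd) (s t u : Memory) (w₁ d₁ w₂ d₂ : ℕ)
      (hb : b.eval s 0) (h₁ : Exec B c s t w₁ d₁) (h₂ : Exec B (Cmd.loop b c) t u w₂ d₂) :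
      Exec B (Cmd.loop b c) s u (b.cost + w₁ + w₂) (b.cost + d₁ + d₂)

end PRAM

/-! ## The problem: generating `(1,ρ)`-balls -/

open Classical in
/-- The initial memory. Integer array `0` holds `n`, `m`, `ρ`; integer array `1` holds, at
`v = 0, …, n`, the number of arcs with tail `< v`, that is, the index of the first arc out of `v`;
integer arrays `2`, `3` and real array `0` hold the tails, heads and weights of the `2m` arcs.
All other cells are zero. -/
noncomputable def ballInput {n : ℕ} (G : WGraph n) (A : G.AdjArrays) (ρ : ℕ) : PRAM.Memory where
  int a j :=
    if a = 0 then (if j = 0 then n else if j = 1 then G.numEdges else if j = 2 then ρ else 0)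
    else if a = 1 then
      (if j ≤ n then (Finset.univ.filter fun e => ((A.arc e).fst : ℕ) < j).card else 0)
    else if a = 2 then (if h : j < 2 * G.numEdges then (A.arc ⟨j, h⟩).fst else 0)
    else if a = 3 then (if h : j < 2 * G.numEdges then (A.arc ⟨j, h⟩).snd else 0)
    else 0
  real a j :=
    if a = 0 then (if h : j < 2 * G.numEdges then G.weight (A.arc ⟨j, h⟩).edge else 0) else 0

/-- The memory `t` holds `(1,ρ)`-balls for all vertices: for each vertex `v` it lists, in the cells
`vρ, …, vρ + ρ - 1`, the `ρ` vertices nearest to `v` (ties broken arbitrarily) in integer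
array `4` and their distances from `v`, the weights of the shortcuts, in real array `1`; the
`ρ`-nearest distance of `v` is in cell `v` of real array `2`; and the graph with these shortcuts
added has the distances of `G` and is a `(1,ρ)`-graph. -/
def GeneratesBalls {n : ℕ} (G : WGraph n) (ρ : ℕ) (t : PRAM.Memory) : Prop :=
  ∃ nbr : Fin n → Fin ρ → Fin n,
    (∀ (v : Fin n) (i : Fin ρ), t.int 4 (v * ρ + i) = nbr v i) ∧
    (∀ v, Function.Injective (nbr v)) ∧
    (∀ v i x, x ∉ Set.range (nbr v) → G.dist v (nbr v i) ≤ G.dist v x) ∧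
    (∀ (v : Fin n) (i : Fin ρ), t.real 1 (v * ρ + i) = G.dist v (nbr v i)) ∧
    (∀ v : Fin n, t.real 2 v = G.nearestDist ρ v) ∧
    (∀ u v, (G.withShortcuts fun v => Set.range (nbr v)).dist u v = G.dist u v) ∧
    (G.withShortcuts fun v => Set.range (nbr v)).IsBallGraph 1 ρ

/-- The program `P` generates `(1,ρ)`-balls on every connected graph with `n` vertices and `m`
edges, for all `1 ≤ ρ ≤ n`, in work `O(work n m ρ)` and depth `O(depth ρ)` and with words of
`O(log n)` bits. -/
def GeneratesBallsWithin (P : PRAM.Cmd) (work : ℕ → ℕ → ℕ → ℝ) (depth : ℕ → ℝ) : Prop :=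
  ∃ (C : ℝ) (c : ℕ), ∀ (n : ℕ) (G : WGraph n) (A : G.AdjArrays) (ρ : ℕ),
    G.graph.Connected → 1 ≤ ρ → ρ ≤ n →
    ∃ (t : PRAM.Memory) (w d : ℕ),
      PRAM.Exec ((n + 1) ^ c) P (ballInput G A ρ) t w d ∧
      GeneratesBalls G ρ t ∧
      (w : ℝ) ≤ C * work n G.numEdges ρ ∧
      (d : ℝ) ≤ C * depth ρ

/-! One program, of work `O(m + nρ²)` and depth `O(ρ)`, meets both pairs of bounds: an edge forces
`n ≥ 2` and hence `m ≤ 2 m log n`, and `ρ ≤ ρ²`, `1 ≤ 2 log (ρ + 1)`.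

Dijkstra searches from all vertices run in lockstep for `ρ` rounds, each round settling one vertex
in every search. Only the `ρ` lightest arcs out of each vertex are looked at. This is enough: a
shortest path to an unsettled vertex leaves the settled set by some arc `e`; if `e` is missing from
the list of its tail, the list consists of `ρ` arcs that are no heavier and have distinct heads,
while fewer than `ρ` vertices are settled, so one of these heads is unsettled and is an equally good
candidate (`SearchInv.exists_live`).

A round has to run in constant depth. Priority writing finds a minimum in two steps: all candidates
write their keys to one cell, then those that attain the stored key write their names
(`blockMin_of_wr`). To afford deletions, each group (the arcs out of one vertex, or the reached
vertices of one search) is split into blocks with stored minima. A round compares block minima only,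
and then rescans only the blocks of the selected elements, with `ρ` processors per group
(`runs_popCmd`).

For arcs, a block consists of the arcs with one tail whose numbers lie in one interval of length
`ρ`. There are `O(n + m/ρ)` blocks, so `ρ` rounds cost `O(m + nρ²)` and no sorting is needed. For
searches, a block consists of the vertices first reached in one round. They are heads of arcs in the
list of the vertex settled in that round, so `ρ` processors enumerate them, and a search has at most
`ρ` blocks (`searchPop_runs`). The round of first reach never changes and tentative distances only
drop, so relaxation is also repaired by two priority writes (`searchRound_runs`).

Shortcuts are weighted by distances, so no distance changes. A listed vertex is then within one hop,
so a vertex more than one hop away is unlisted and at least as far as every listed one. -/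

namespace PRAM

/-! ### Memories, concurrent writes and running times -/

/-- Replacement of an integer array. -/
def Memory.setI (s : Memory) (a : ℕ) (f : ℕ → ℕ) : Memory :=
  { s with int := Function.update s.int a f }

/-- Replacement of a real array. -/
def Memory.setR (s : Memory) (a : ℕ) (f : ℕ → ℝ) : Memory :=
  { s with real := Function.update s.real a f }

@[simp] theorem Memory.setI_real (s : Memory) (a : ℕ) (f : ℕ → ℕ) :
    (s.setI a f).real = s.real := rfl

@[simp] theorem Memory.setR_int (s : Memory) (a : ℕ) (f : ℕ → ℝ) :
    (s.setR a f).int = s.int := rfl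

@[simp] theorem Memory.setI_int_self (s : Memory) (a : ℕ) (f : ℕ → ℕ) :
    (s.setI a f).int a = f := by simp [Memory.setI]

@[simp] theorem Memory.setR_real_self (s : Memory) (a : ℕ) (f : ℕ → ℝ) :
    (s.setR a f).real a = f := by simp [Memory.setR]

@[simp] theorem Memory.setI_int_of_ne (s : Memory) {a b : ℕ} (f : ℕ → ℕ) (h : b ≠ a) :
    (s.setI a f).int b = s.int b := by simp [Memory.setI, h]

@[simp] theorem Memory.setR_real_of_ne (s : Memory) {a b : ℕ} (f : ℕ → ℝ) (h : b ≠ a) :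
    (s.setR a f).real b = s.real b := by simp [Memory.setR, h]

/-- `new` arises from `old` by a priority write of the processors `q < N` with `act q`, where `q`
writes `val q` to the cell `addr q`. -/
def Wr {α : Type} [LinearOrder α] (N : ℕ) (act : ℕ → Prop) (addr : ℕ → ℕ) (val : ℕ → α)
    (old new : ℕ → α) : Prop :=
  ∀ c, (∃ q < N, act q ∧ addr q = c ∧ new c = val q ∧
      ∀ q' < N, act q' → addr q' = c → val q ≤ val q') ∨
    ((∀ q < N, act q → addr q ≠ c) ∧ new c = old c)

theorem wr_concurrentWrite {α : Type} [LinearOrder α] (N : ℕ) (act : ℕ → Prop) (addr : ℕ → ℕ)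
    (val : ℕ → α) (old : ℕ → α) : Wr N act addr val old (concurrentWrite N act addr val old) := by
  classical
  intro c
  by_cases h : ((Finset.range N).filter fun q => act q ∧ addr q = c).Nonempty
  · left
    obtain ⟨q, hq, hv⟩ := Finset.exists_mem_eq_inf' h val
    simp only [Finset.mem_filter, Finset.mem_range] at hq
    have hc : concurrentWrite N act addr val old c = val q := by
      rw [← hv]
      unfold concurrentWrite
      convert dif_pos _ using 2
    refine ⟨q, hq.1, hq.2.1, hq.2.2, hc, fun q' h1 h2 h3 => ?_⟩
    rw [← hv]
    exact Finset.inf'_le _ (by simp [h1, h2, h3])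
  · right
    refine ⟨fun q h1 h2 h3 => h ⟨q, by simp [h1, h2, h3]⟩, ?_⟩
    unfold concurrentWrite
    convert dif_neg _ using 2
    convert h

theorem Wr.congr {α : Type} [LinearOrder α] {N : ℕ} {act act' : ℕ → Prop} {addr addr' : ℕ → ℕ}
    {val val' : ℕ → α} {old new : ℕ → α} (h : Wr N act addr val old new)
    (h₁ : ∀ q < N, (act q ↔ act' q)) (h₂ : ∀ q < N, act' q → addr q = addr' q)
    (h₃ : ∀ q < N, act' q → val q = val' q) : Wr N act' addr' val' old new := by
  intro c
  rcases h c with ⟨q, hq, ha, hc, hv, hm⟩ | ⟨hn, ho⟩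
  · have ha' := (h₁ q hq).1 ha
    refine Or.inl ⟨q, hq, ha', (h₂ q hq ha').symm.trans hc, hv.trans (h₃ q hq ha'), ?_⟩
    intro q' hq' hb hc'
    rw [← h₃ q hq ha', ← h₃ q' hq' hb]
    exact hm q' hq' ((h₁ q' hq').2 hb) ((h₂ q' hq' hb).trans hc')
  · exact Or.inr ⟨fun q hq ha' hc => hn q hq ((h₁ q hq).2 ha') ((h₂ q hq ha').trans hc), ho⟩

/-- The number of operations that one processor performs in the parallel steps of a program, loop
bodies being counted once. -/
def Cmd.size : Cmd → ℕ
  | skip => 0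
  | iwrite p b _ i x => p.cost + (b.cost + i.cost + x.cost + 1)
  | rwrite p b _ i x => p.cost + (b.cost + i.cost + x.cost + 1)
  | seq c d => c.size + d.size
  | ite b c d => b.cost + (c.size + d.size)
  | loop b c => b.cost + c.size

/-- The program runs from `s` to `t`, with work and depth as for a single pass through it with at
most `N` processors. -/
def Runs (B N : ℕ) (c : Cmd) (s t : Memory) : Prop :=
  ∃ w d, Exec B c s t w d ∧ w ≤ c.size * (N + 1) ∧ d ≤ c.size

theorem Runs.seq {B N : ℕ} {c d : Cmd} {s t u : Memory} (h₁ : Runs B N c s t)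
    (h₂ : Runs B N d t u) : Runs B N (Cmd.seq c d) s u := by
  obtain ⟨w, k, e, hw, hk⟩ := h₁
  obtain ⟨w', k', e', hw', hk'⟩ := h₂
  refine ⟨_, _, Exec.seq _ _ _ _ _ _ _ _ _ e e', ?_, ?_⟩
  · simp only [Cmd.size]; nlinarith
  · simp only [Cmd.size]; omega

theorem step_cost_le {a k p N : ℕ} (h : p ≤ N) : a + p * k ≤ (a + k) * (N + 1) := by
  have := Nat.mul_le_mul_right k h
  nlinarith

theorem runs_iwrite {B N : ℕ} (s : Memory) (p : IExpr) (b : BExpr) (a : ℕ) (i x : IExpr)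
    {k : ℕ} {act : ℕ → Prop} {addr val : ℕ → ℕ} (hp : p.eval s 0 = k) (hkB : k ≤ B) (hkN : k ≤ N)
    (hb : ∀ q < k, (b.eval s q ↔ act q)) (hi : ∀ q < k, act q → i.eval s q = addr q)
    (hx : ∀ q < k, act q → x.eval s q = val q)
    (hB : ∀ q < k, act q → addr q ≤ B ∧ val q ≤ B) :
    ∃ f, Runs B N (Cmd.iwrite p b a i x) s (s.setI a f) ∧ Wr k act addr val (s.int a) f := by
  subst hp
  refine ⟨_, ⟨_, _, Exec.iwrite s p b a i x hkB fun q hq h => ?_, step_cost_le hkN, le_rfl⟩,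
    (wr_concurrentWrite _ _ _ _ _).congr hb hi hx⟩
  have ha := (hb q hq).1 h
  rw [hi q hq ha, hx q hq ha]
  exact hB q hq ha

theorem runs_rwrite {B N : ℕ} (s : Memory) (p : IExpr) (b : BExpr) (a : ℕ) (i : IExpr)
    (x : RExpr) {k : ℕ} {act : ℕ → Prop} {addr : ℕ → ℕ} {val : ℕ → ℝ} (hp : p.eval s 0 = k)
    (hkB : k ≤ B) (hkN : k ≤ N) (hb : ∀ q < k, (b.eval s q ↔ act q))
    (hi : ∀ q < k, act q → i.eval s q = addr q) (hx : ∀ q < k, act q → x.eval s q = val q)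
    (hB : ∀ q < k, act q → addr q ≤ B) :
    ∃ f, Runs B N (Cmd.rwrite p b a i x) s (s.setR a f) ∧ Wr k act addr val (s.real a) f := by
  subst hp
  refine ⟨_, ⟨_, _, Exec.rwrite s p b a i x hkB fun q hq h => ?_, step_cost_le hkN, le_rfl⟩,
    (wr_concurrentWrite _ _ _ _ _).congr hb hi hx⟩
  have ha := (hb q hq).1 h
  rw [hi q hq ha]
  exact hB q hq ha

/-- A while loop whose invariant counts its `R` passes. -/
theorem exec_loop {B N R : ℕ} {b : BExpr} {c : Cmd} (Inv : ℕ → Memory → Prop)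
    (hstep : ∀ k < R, ∀ s, Inv k s → b.eval s 0 ∧ ∃ t, Runs B N c s t ∧ Inv (k + 1) t)
    (hend : ∀ s, Inv R s → ¬ b.eval s 0) {k : ℕ} (hk : k ≤ R) {s : Memory} (hs : Inv k s) :
    ∃ t w d, Exec B (Cmd.loop b c) s t w d ∧ Inv R t ∧
      w ≤ (R - k + 1) * ((Cmd.loop b c).size * (N + 1)) ∧
      d ≤ (R - k + 1) * (Cmd.loop b c).size := by
  induction h : R - k generalizing k s with
  | zero =>
    obtain rfl : k = R := by omega
    -- The `+ 1` in the number of passes pays for the last test, which fails.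
    refine ⟨s, _, _, Exec.loop_false _ _ _ (hend s hs), hs, ?_, ?_⟩ <;> simp only [Cmd.size] <;>
      nlinarith
  | succ j ih =>
    obtain ⟨hb, t, ⟨w, d, he, hw, hd⟩, ht⟩ := hstep k (by omega) s hs
    obtain ⟨u, w', d', he', hu, hw', hd'⟩ := ih (k := k + 1) (by omega) ht (by omega)
    refine ⟨u, _, _, Exec.loop_true _ _ _ _ _ _ _ _ _ hb he he', hu, ?_, ?_⟩ <;>
      simp only [Cmd.size] at * <;> nlinarith

/-! ### Priority queues with block minima

Elements are grouped into blocks; `barg c` is `0` if the block `c` is empty and otherwise `e + 1`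
for an element `e` of least key in it. -/

/-- The array `barg` holds the block minima of the set `alive`. -/
structure BlockMin (alive : ℕ → Prop) (key : ℕ → ℝ) (blk : ℕ → ℕ) (barg : ℕ → ℕ) : Prop where
  sound : ∀ c e, barg c = e + 1 → alive e ∧ blk e = c
  min : ∀ e, alive e → ∃ e', barg (blk e) = e' + 1 ∧ key e' ≤ key e

/-- Repair of block minima by two priority writes. -/
theorem blockMin_of_wr {alive : ℕ → Prop} {key : ℕ → ℝ} {blk barg barg' : ℕ → ℕ}
    {scr scr' : ℕ → ℝ} {N : ℕ} {act : ℕ → Prop} {el : ℕ → ℕ}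
    (hsound : ∀ c e, barg c = e + 1 → alive e ∧ blk e = c)
    (hact : ∀ q < N, act q → alive (el q) ∧
      ∀ e, barg (blk (el q)) = e + 1 → key (el q) < key e)
    (hcov : ∀ e, alive e → (∃ q < N, act q ∧ el q = e) ∨
      ∃ e', barg (blk e) = e' + 1 ∧ key e' ≤ key e)
    (h₁ : Wr N act (fun q => blk (el q)) (fun q => key (el q)) scr scr')
    (h₂ : Wr N (fun q => act q ∧ ¬ scr' (blk (el q)) < key (el q)) (fun q => blk (el q))
      (fun q => el q + 1) barg barg') :
    BlockMin alive key blk barg' := by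
  constructor
  · intro c e hc
    rcases h₂ c with ⟨q, hq, ha, haddr, hv, -⟩ | ⟨-, ho⟩
    · dsimp only at hv haddr
      obtain rfl : el q = e := by omega
      exact ⟨(hact q hq ha.1).1, haddr⟩
    · exact hsound c e (ho ▸ hc)
  · intro e he
    rcases h₂ (blk e) with ⟨q, hq, ⟨ha, hle⟩, haddr, hv, -⟩ | ⟨hno, ho⟩
    · refine ⟨_, hv, ?_⟩
      -- The block has a new minimum, whose key is the least one offered. If `e` was not offered,
      -- the old minimum is no worse than `e` and is strictly beaten by every offer. Only scratch
      -- cells written in the preceding step are consulted, so the scratch array need not be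
      -- cleared.
      rcases h₁ (blk e) with ⟨q₀, hq₀, ha₀, haddr₀, hv₀, hm₀⟩ | ⟨hno, -⟩
      · simp only [haddr, hv₀, not_lt] at hle
        rcases hcov e he with ⟨q₁, hq₁, ha₁, rfl⟩ | ⟨e', he', hk⟩
        · exact hle.trans (hm₀ q₁ hq₁ ha₁ rfl)
        · exact (((hact q hq ha).2 e' (by simpa only [haddr] using he')).trans_le hk).le
      · exact absurd haddr (hno q hq ha)
    -- The block kept its entry. Then nothing was offered to it, since a processor attaining the
    -- least offered key would have passed the test.
    · rw [ho]
      rcases hcov e he with ⟨q₁, hq₁, ha₁, rfl⟩ | h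
      · rcases h₁ (blk (el q₁)) with ⟨q₀, hq₀, ha₀, haddr₀, hv₀, -⟩ | ⟨hno₁, -⟩
        · refine absurd haddr₀ (hno q₀ hq₀ ⟨ha₀, ?_⟩)
          simp only [haddr₀, hv₀, lt_irrefl, not_false_iff]
        · exact absurd rfl (hno₁ q₁ hq₁ ha₁)
      · exact h

theorem mul_add_inj {ρ g g' r r' : ℕ} (hr : r < ρ) (hr' : r' < ρ)
    (h : g * ρ + r = g' * ρ + r') : g = g' ∧ r = r' := by
  have h1 : (g * ρ + r) / ρ = g := by
    rw [mul_comm, Nat.mul_add_div (by omega), Nat.div_eq_of_lt hr, add_zero]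
  have h2 : (g' * ρ + r') / ρ = g' := by
    rw [mul_comm, Nat.mul_add_div (by omega), Nat.div_eq_of_lt hr', add_zero]
  rw [h, h2] at h1
  subst h1
  exact ⟨rfl, by omega⟩

/-! ### Selection of a least element in every group -/

/-- The element `e` is among those selected in round `r` from the groups `g < n`. -/
def Popped (n ρ r : ℕ) (sel : ℕ → ℕ) (e : ℕ) : Prop := ∃ g < n, sel (g * ρ + r) = e + 1

/-- In round `r` an element of least key is selected and marked in every group that has one. -/
structure PopSpec (n ρ r : ℕ) (alive : ℕ → Prop) (key : ℕ → ℝ) (grp : ℕ → ℕ)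
    (sel : ℕ → ℕ) (selw : ℕ → ℝ) (dead : ℕ → ℕ) (sel' : ℕ → ℕ) (selw' : ℕ → ℝ)
    (dead' : ℕ → ℕ) : Prop where
  pop : ∀ g < n, (∃ e, alive e ∧ grp e = g ∧ sel' (g * ρ + r) = e + 1 ∧
      selw' (g * ρ + r) = key e ∧ ∀ e', alive e' → grp e' = g → key e ≤ key e') ∨
    (sel' (g * ρ + r) = 0 ∧ ∀ e, alive e → grp e ≠ g)
  other : ∀ c, (∀ g < n, c ≠ g * ρ + r) → sel' c = sel c ∧ selw' c = selw c
  dead_of_popped : ∀ e, Popped n ρ r sel' e → dead' e = 1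
  dead_of_not : ∀ e, ¬ Popped n ρ r sel' e → dead' e = dead e

theorem PopSpec.alive_of_popped {n ρ r : ℕ} {alive : ℕ → Prop} {key : ℕ → ℝ} {grp : ℕ → ℕ}
    {sel : ℕ → ℕ} {selw : ℕ → ℝ} {dead sel' : ℕ → ℕ} {selw' : ℕ → ℝ} {dead' : ℕ → ℕ}
    (h : PopSpec n ρ r alive key grp sel selw dead sel' selw' dead') {g e : ℕ} (hg : g < n)
    (he : sel' (g * ρ + r) = e + 1) : alive e ∧ grp e = g ∧ selw' (g * ρ + r) = key e ∧
      ∀ e', alive e' → grp e' = g → key e ≤ key e' := by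
  rcases h.pop g hg with ⟨e₁, h1, h2, h3, h4⟩ | ⟨h1, -⟩
  · obtain rfl : e₁ = e := by omega
    exact ⟨h1, h2, h4⟩
  · omega

/-- The tournament is now held among block minima. By `hbg` blocks refine groups, so the least block
minimum is the least key of its group. By `hfresh` a group without candidates keeps the entry `0`,
and `hr` keeps the cells of different groups apart. -/
theorem popSpec_of_wr {n ρ r N : ℕ} {alive : ℕ → Prop} {key : ℕ → ℝ} {grp blk : ℕ → ℕ}
    {barg : ℕ → ℕ} {sel : ℕ → ℕ} {selw : ℕ → ℝ} {dead sel' : ℕ → ℕ} {selw' : ℕ → ℝ}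
    {dead' : ℕ → ℕ} (hr : r < ρ) (hbm : BlockMin alive key blk barg)
    (hgrp : ∀ e, alive e → grp e < n) (hblk : ∀ e, alive e → blk e < N)
    (hbg : ∀ e e', alive e → alive e' → blk e = blk e' → grp e = grp e')
    (hfresh : ∀ g < n, sel (g * ρ + r) = 0)
    (h₁ : Wr N (fun q => 0 < barg q) (fun q => grp (barg q - 1) * ρ + r)
      (fun q => key (barg q - 1)) selw selw')
    (h₂ : Wr N (fun q => 0 < barg q ∧ ¬ selw' (grp (barg q - 1) * ρ + r) < key (barg q - 1))
      (fun q => grp (barg q - 1) * ρ + r) (fun q => barg q) sel sel')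
    (h₃ : Wr n (fun q => 0 < sel' (q * ρ + r)) (fun q => sel' (q * ρ + r) - 1)
      (fun _ => 1) dead dead') :
    PopSpec n ρ r alive key grp sel selw dead sel' selw' dead' := by
  have hpos : ∀ q, 0 < barg q → ∃ e, barg q = e + 1 ∧ alive e ∧ blk e = q := fun q hq =>
    ⟨barg q - 1, by omega, hbm.sound _ _ (by omega)⟩
  refine ⟨fun g hg => ?_, fun c hc => ⟨?_, ?_⟩, ?_, ?_⟩
  · rcases h₁ (g * ρ + r) with ⟨q₀, hq₀, ha₀, haddr₀, hv₀, hm₀⟩ | ⟨hno, -⟩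
    · left
      have hle : ∀ e, alive e → grp e = g → selw' (g * ρ + r) ≤ key e := by
        intro e he hge
        obtain ⟨e', he', hk⟩ := hbm.min e he
        obtain ⟨ha', hb'⟩ := hbm.sound _ _ he'
        have hge' : grp e' = g := (hbg e' e ha' he hb').trans hge
        refine hv₀.trans_le (le_trans ?_ hk)
        simpa [he'] using hm₀ (blk e) (hblk e he) (by omega) (by simp [he', hge'])
      rcases h₂ (g * ρ + r) with ⟨q, hq, ⟨ha, hle'⟩, haddr, hv, -⟩ | ⟨hno, -⟩
      · obtain ⟨e, h1, h2, h3⟩ := hpos q ha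
        simp only [h1, Nat.add_sub_cancel] at haddr hle' hv
        have hg1 := (mul_add_inj hr hr haddr).1
        rw [hg1, not_lt] at hle'
        exact ⟨e, h2, hg1, hv, le_antisymm (hle e h2 hg1) hle',
          fun e' h h' => hle'.trans (hle e' h h')⟩
      · refine absurd haddr₀ (hno q₀ hq₀ ⟨ha₀, ?_⟩)
        dsimp only at haddr₀
        rw [haddr₀, hv₀]
        exact lt_irrefl _
    · right
      have hno' : ∀ q < N, 0 < barg q → grp (barg q - 1) * ρ + r ≠ g * ρ + r := hno
      constructor
      · rcases h₂ (g * ρ + r) with ⟨q, hq, ⟨ha, -⟩, haddr, -⟩ | ⟨-, ho⟩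
        · exact absurd haddr (hno q hq ha)
        · exact ho.trans (hfresh g hg)
      · intro e he hge
        obtain ⟨e', he', -⟩ := hbm.min e he
        obtain ⟨ha', hb'⟩ := hbm.sound _ _ he'
        refine hno' (blk e) (hblk e he) (by omega) ?_
        rw [he', Nat.add_sub_cancel, hbg e' e ha' he hb', hge]
  · rcases h₂ c with ⟨q, hq, ⟨ha, -⟩, haddr, -⟩ | ⟨-, ho⟩
    · obtain ⟨e, h1, h2, h3⟩ := hpos q ha
      exact absurd haddr.symm (hc _ (by rw [h1]; exact hgrp e h2))
    · exact ho
  · rcases h₁ c with ⟨q, hq, ha, haddr, -⟩ | ⟨-, ho⟩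
    · obtain ⟨e, h1, h2, h3⟩ := hpos q ha
      exact absurd haddr.symm (hc _ (by rw [h1]; exact hgrp e h2))
    · exact ho
  · rintro e ⟨g, hg, he⟩
    rcases h₃ e with ⟨q, hq, -, -, hv, -⟩ | ⟨hno, -⟩
    · exact hv
    · have hno' : ∀ q < n, 0 < sel' (q * ρ + r) → sel' (q * ρ + r) - 1 ≠ e := hno
      exact absurd (by omega) (hno' g hg (by omega))
  · intro e he
    rcases h₃ e with ⟨q, hq, ha, haddr, -⟩ | ⟨-, ho⟩
    · dsimp only at ha haddr
      exact absurd ⟨q, hq, by omega⟩ he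
    · exact ho

/-- The program that repairs block minima: every processor `q < np` with `guard` offers the element
`elem` to its block `cell`. -/
def fixCmd (np : IExpr) (guard : BExpr) (cell elem : IExpr) (barg key scr : ℕ) : Cmd :=
  .seq (.rwrite np guard scr cell (.read key elem))
    (.iwrite np (.and guard (.not (.rlt (.read scr cell) (.read key elem)))) barg cell
      (.add elem (.const 1)))

/-- The program that selects, in round `rnd`, an element of least key in every group, marks it as
dead, and repairs the minima of the blocks of the selected elements. -/
def popCmd (nb rnd : IExpr) (sel barg dead key selw scr : ℕ) (grp blk : IExpr → IExpr)
    (guard : BExpr) (elem : IExpr) : Cmd :=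
  .seq (.rwrite nb (.ilt (.const 0) (.read barg .pid)) selw
      (.add (.mul (grp (.sub (.read barg .pid) (.const 1))) (.read 0 (.const 2))) rnd)
      (.read key (.sub (.read barg .pid) (.const 1)))) <|
  .seq (.iwrite nb (.and (.ilt (.const 0) (.read barg .pid)) (.not (.rlt
        (.read selw
          (.add (.mul (grp (.sub (.read barg .pid) (.const 1))) (.read 0 (.const 2))) rnd))
        (.read key (.sub (.read barg .pid) (.const 1)))))) sel
      (.add (.mul (grp (.sub (.read barg .pid) (.const 1))) (.read 0 (.const 2))) rnd)
      (.read barg .pid)) <|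
  .seq (.iwrite (.read 0 (.const 0))
      (.ilt (.const 0) (.read sel (.add (.mul .pid (.read 0 (.const 2))) rnd))) dead
      (.sub (.read sel (.add (.mul .pid (.read 0 (.const 2))) rnd)) (.const 1)) (.const 1)) <|
  .seq (.iwrite (.read 0 (.const 0))
      (.ilt (.const 0) (.read sel (.add (.mul .pid (.read 0 (.const 2))) rnd))) barg
      (blk (.sub (.read sel (.add (.mul .pid (.read 0 (.const 2))) rnd)) (.const 1))) (.const 0))
  (fixCmd (.mul (.read 0 (.const 0)) (.read 0 (.const 2))) guard (blk elem) elem barg key scr)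

/-- The memories `s` and `t` agree outside the integer arrays in `I` and the real arrays in `R`. -/
def AgreeOff (I R : List ℕ) (s t : Memory) : Prop :=
  (∀ a, a ∉ I → t.int a = s.int a) ∧ ∀ a, a ∉ R → t.real a = s.real a

theorem AgreeOff.setI {I R : List ℕ} {s t : Memory} (h : AgreeOff I R s t) {a : ℕ} (ha : a ∈ I)
    (f : ℕ → ℕ) : AgreeOff I R s (t.setI a f) :=
  ⟨fun b hb => by rw [Memory.setI_int_of_ne _ _ (by rintro rfl; exact hb ha), h.1 b hb], h.2⟩

theorem AgreeOff.setR {I R : List ℕ} {s t : Memory} (h : AgreeOff I R s t) {a : ℕ} (ha : a ∈ R)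
    (f : ℕ → ℝ) : AgreeOff I R s (t.setR a f) :=
  ⟨h.1, fun b hb => by rw [Memory.setR_real_of_ne _ _ (by rintro rfl; exact hb ha), h.2 b hb]⟩

theorem AgreeOff.refl (I R : List ℕ) (s : Memory) : AgreeOff I R s s :=
  ⟨fun _ _ => rfl, fun _ _ => rfl⟩

/-- This serves to build minima from nothing, to rebuild blocks after a deletion, and to account for
decreased keys. The evaluations are required for every content `f` of the scratch array because that
array changes between the two writes. -/
theorem runs_fixCmd {B N : ℕ} (s : Memory) {np : IExpr} {guard : BExpr} {cell elem : IExpr}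
    {barg key scr : ℕ} {k : ℕ} {act : ℕ → Prop} {el blk : ℕ → ℕ} {alive : ℕ → Prop}
    (hks : key ≠ scr) (hkB : k ≤ B) (hkN : k ≤ N)
    (hnp : ∀ f, np.eval (s.setR scr f) 0 = k)
    (hguard : ∀ f, ∀ q < k, (guard.eval (s.setR scr f) q ↔ act q))
    (hcell : ∀ f, ∀ q < k, act q → cell.eval (s.setR scr f) q = blk (el q))
    (helem : ∀ f, ∀ q < k, act q → elem.eval (s.setR scr f) q = el q)
    (hB : ∀ e, alive e → blk e ≤ B ∧ e + 1 ≤ B)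
    (hsound : ∀ c e, s.int barg c = e + 1 → alive e ∧ blk e = c)
    (hact : ∀ q < k, act q → alive (el q) ∧
      ∀ e, s.int barg (blk (el q)) = e + 1 → s.real key (el q) < s.real key e)
    (hcov : ∀ e, alive e → (∃ q < k, act q ∧ el q = e) ∨
      ∃ e', s.int barg (blk e) = e' + 1 ∧ s.real key e' ≤ s.real key e) :
    ∃ f g, Runs B N (fixCmd np guard cell elem barg key scr) s ((s.setR scr f).setI barg g) ∧
      BlockMin alive (s.real key) blk g := by
  -- For the first write, `f` is the present content of the scratch array.
  have hs : s.setR scr (s.real scr) = s := by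
    simp [Memory.setR]
  obtain ⟨f, hrun, hw⟩ := runs_rwrite (N := N) s np guard scr cell (.read key elem) (act := act)
    (addr := fun q => blk (el q)) (val := fun q => s.real key (el q))
    (by simpa only [hs] using hnp (s.real scr)) hkB hkN
    (by simpa only [hs] using hguard (s.real scr))
    (by simpa only [hs] using hcell (s.real scr))
    (fun q hq ha => by
      have := helem (s.real scr) q hq ha
      rw [hs] at this
      simp only [RExpr.eval, this])
    (fun q hq ha => (hB _ (hact q hq ha).1).1)
  obtain ⟨g, hrun', hw'⟩ := runs_iwrite (N := N) (s.setR scr f) np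
    (.and guard (.not (.rlt (.read scr cell) (.read key elem)))) barg cell (.add elem (.const 1))
    (act := fun q => act q ∧ ¬ f (blk (el q)) < s.real key (el q))
    (addr := fun q => blk (el q)) (val := fun q => el q + 1) (hnp f) hkB hkN
    (fun q hq => by
      simp only [BExpr.eval, RExpr.eval, hguard f q hq, Memory.setR_real_self,
        Memory.setR_real_of_ne _ _ hks]
      exact and_congr_right fun ha => by rw [hcell f q hq ha, helem f q hq ha])
    (fun q hq ha => hcell f q hq ha.1)
    (fun q hq ha => by simp only [IExpr.eval, helem f q hq ha.1])
    (fun q hq ha => hB _ (hact q hq ha.1).1)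
  exact ⟨f, g, hrun.seq hrun', blockMin_of_wr hsound hact hcov hw hw'⟩

/-- The hypothesis `hG` is what an application has to supply: after any legitimate selection, the `n
* ρ` guarded processors enumerate exactly the surviving elements that share a block with a selected
one. These blocks are emptied and rebuilt, and the others keep their minima. Expressions are
evaluated in any memory that differs from `s` only in the arrays changed by the command. -/
theorem runs_popCmd {B N : ℕ} (s : Memory) {n ρ r k : ℕ} {nb rnd : IExpr}
    {sel barg dead key selw scr : ℕ} {grp blk : IExpr → IExpr} {guard : BExpr} {elem : IExpr}
    {G : (ℕ → ℕ) → (ℕ → ℕ) → ℕ → Prop} {el : (ℕ → ℕ) → ℕ → ℕ} {γ β : ℕ → ℕ} {alive : ℕ → Prop}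
    (hne : sel ≠ barg ∧ sel ≠ dead ∧ barg ≠ dead ∧ key ≠ selw ∧ key ≠ scr ∧ selw ≠ scr)
    (hne0 : 0 ≠ sel ∧ 0 ≠ barg ∧ 0 ≠ dead)
    (hn : s.int 0 0 = n) (hρ : s.int 0 2 = ρ) (hr : r < ρ) (hkB : k ≤ B) (hkN : k ≤ N)
    (hnB : n ≤ B) (hnN : n ≤ N) (hnρB : n * ρ ≤ B) (hnρN : n * ρ ≤ N)
    (hnb : ∀ t, AgreeOff [sel, barg, dead] [selw, scr] s t → nb.eval t 0 = k)
    (hrnd : ∀ t, AgreeOff [sel, barg, dead] [selw, scr] s t → ∀ q, rnd.eval t q = r)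
    (hgrp : ∀ t, AgreeOff [sel, barg, dead] [selw, scr] s t → ∀ x q, alive (x.eval t q) →
      (grp x).eval t q = γ (x.eval t q))
    (hblk : ∀ t, AgreeOff [sel, barg, dead] [selw, scr] s t → ∀ x q, alive (x.eval t q) →
      (blk x).eval t q = β (x.eval t q))
    (helem : ∀ t, AgreeOff [sel, barg, dead] [selw, scr] s t → ∀ q,
      elem.eval t q = el (t.int sel) q)
    (hguard : ∀ t, AgreeOff [sel, barg, dead] [selw, scr] s t → ∀ q,
      (guard.eval t q ↔ G (t.int sel) (t.int dead) q))
    (hbm : BlockMin alive (s.real key) β (s.int barg))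
    (hγ : ∀ e, alive e → γ e < n) (hβ : ∀ e, alive e → β e < k)
    (hβγ : ∀ e e', alive e → alive e' → β e = β e' → γ e = γ e')
    (heB : ∀ e, alive e → e + 1 ≤ B)
    (hfresh : ∀ g < n, s.int sel (g * ρ + r) = 0)
    (hG : ∀ sel' selw' dead', PopSpec n ρ r alive (s.real key) γ (s.int sel) (s.real selw)
      (s.int dead) sel' selw' dead' →
      (∀ q < n * ρ, G sel' dead' q → (alive (el sel' q) ∧ ¬ Popped n ρ r sel' (el sel' q)) ∧
        ∃ e, Popped n ρ r sel' e ∧ β (el sel' q) = β e) ∧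
      ∀ e, alive e → ¬ Popped n ρ r sel' e → ∀ e', Popped n ρ r sel' e' → β e = β e' →
        ∃ q < n * ρ, G sel' dead' q ∧ el sel' q = e) :
    ∃ t, Runs B N (popCmd nb rnd sel barg dead key selw scr grp blk guard elem) s t ∧
      AgreeOff [sel, barg, dead] [selw, scr] s t ∧
      PopSpec n ρ r alive (s.real key) γ (s.int sel) (s.real selw) (s.int dead)
        (t.int sel) (t.real selw) (t.int dead) ∧
      BlockMin (fun e => alive e ∧ ¬ Popped n ρ r (t.int sel) e) (s.real key) β (t.int barg) := by
  obtain ⟨h_sb, h_sd, h_bd, h_kw, h_kc, h_wc⟩ := hne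
  obtain ⟨h_s, h_b, h_d⟩ := hne0
  have hpos : ∀ q, 0 < s.int barg q → alive (s.int barg q - 1) := fun q hq =>
    (hbm.sound q _ (by omega)).1
  have hout : ∀ g < n, g * ρ + r ≤ B := fun g hg =>
    le_trans (by nlinarith [Nat.mul_le_mul_right ρ (Nat.succ_le_of_lt hg)]) hnρB
  have a0 := AgreeOff.refl [sel, barg, dead] [selw, scr] s
  obtain ⟨f₁, run₁, w₁⟩ := runs_rwrite (B := B) (N := N) s nb
    (.ilt (.const 0) (.read barg .pid)) selw
    (.add (.mul (grp (.sub (.read barg .pid) (.const 1))) (.read 0 (.const 2))) rnd)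
    (.read key (.sub (.read barg .pid) (.const 1)))
    (act := fun q => 0 < s.int barg q) (addr := fun q => γ (s.int barg q - 1) * ρ + r)
    (val := fun q => s.real key (s.int barg q - 1)) (hnb s a0) hkB hkN
    (fun q _ => Iff.rfl)
    (fun q _ ha => by
      simp only [IExpr.eval, hrnd s a0, hρ]
      rw [hgrp s a0 (.sub (.read barg .pid) (.const 1)) q (hpos q ha)]
      rfl)
    (fun q _ _ => rfl)
    (fun q _ ha => hout _ (hγ _ (hpos q ha)))
  have a1 := a0.setR (a := selw) (by simp) f₁
  set s₁ := s.setR selw f₁ with hs₁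
  have e₁ : s₁.int = s.int := rfl
  have e₁k : s₁.real key = s.real key := by simp [hs₁, h_kw]
  have e₁w : s₁.real selw = f₁ := by simp [hs₁]
  obtain ⟨f₂, run₂, w₂⟩ := runs_iwrite (B := B) (N := N) s₁ nb
    (.and (.ilt (.const 0) (.read barg .pid)) (.not (.rlt
        (.read selw
          (.add (.mul (grp (.sub (.read barg .pid) (.const 1))) (.read 0 (.const 2))) rnd))
        (.read key (.sub (.read barg .pid) (.const 1)))))) sel
    (.add (.mul (grp (.sub (.read barg .pid) (.const 1))) (.read 0 (.const 2))) rnd)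
    (.read barg .pid)
    (act := fun q => 0 < s.int barg q ∧
      ¬ f₁ (γ (s.int barg q - 1) * ρ + r) < s.real key (s.int barg q - 1))
    (addr := fun q => γ (s.int barg q - 1) * ρ + r)
    (val := fun q => s.int barg q) (hnb s₁ a1) hkB hkN
    (fun q _ => by
      simp only [BExpr.eval, RExpr.eval, IExpr.eval, hrnd s₁ a1, e₁, hρ, e₁k, e₁w]
      refine and_congr_right fun ha => ?_
      rw [hgrp s₁ a1 (.sub (.read barg .pid) (.const 1)) q (hpos q ha)]
      rfl)
    (fun q _ ha => by
      simp only [IExpr.eval, hrnd s₁ a1, e₁, hρ]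
      rw [hgrp s₁ a1 (.sub (.read barg .pid) (.const 1)) q (hpos q ha.1)]
      rfl)
    (fun q _ _ => rfl)
    (fun q _ ha => ⟨hout _ (hγ _ (hpos q ha.1)), by
      have := heB _ (hpos q ha.1)
      have := ha.1
      omega⟩)
  rw [e₁] at w₂
  have a2 := a1.setI (a := sel) (by simp) f₂
  set s₂ := s₁.setI sel f₂ with hs₂
  have e₂s : s₂.int sel = f₂ := by simp [hs₂]
  have e₂ : ∀ a, a ≠ sel → s₂.int a = s.int a := fun a ha => by
    simp [hs₂, hs₁, ha]
  have e₂0 : s₂.int 0 = s.int 0 := e₂ 0 h_s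
  have hsel : ∀ q < n, 0 < f₂ (q * ρ + r) → alive (f₂ (q * ρ + r) - 1) := by
    intro q hq h0
    rcases w₂ (q * ρ + r) with ⟨q', -, ha, -, hv, -⟩ | ⟨-, ho⟩
    · dsimp only at hv
      rw [hv]
      exact hpos q' ha.1
    · rw [ho, hfresh q hq] at h0
      omega
  obtain ⟨f₃, run₃, w₃⟩ := runs_iwrite (B := B) (N := N) s₂ (.read 0 (.const 0))
    (.ilt (.const 0) (.read sel (.add (.mul .pid (.read 0 (.const 2))) rnd))) dead
    (.sub (.read sel (.add (.mul .pid (.read 0 (.const 2))) rnd)) (.const 1)) (.const 1)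
    (act := fun q => 0 < f₂ (q * ρ + r)) (addr := fun q => f₂ (q * ρ + r) - 1)
    (val := fun _ => 1) (by simpa only [IExpr.eval, e₂0] using hn) hnB hnN
    (fun q _ => by simp only [BExpr.eval, IExpr.eval, hrnd s₂ a2, e₂0, hρ, e₂s])
    (fun q _ _ => by simp only [IExpr.eval, hrnd s₂ a2, e₂0, hρ, e₂s])
    (fun q _ _ => rfl)
    (fun q hq ha => by
      have := heB _ (hsel q hq ha)
      constructor <;> omega)
  have a3 := a2.setI (a := dead) (by simp) f₃
  set s₃ := s₂.setI dead f₃ with hs₃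
  have e₃s : s₃.int sel = f₂ := by simp [hs₃, h_sd, e₂s]
  have e₃0 : s₃.int 0 = s.int 0 := by simp [hs₃, h_d, e₂0]
  have e₃b : s₃.int barg = s.int barg := by
    rw [hs₃, Memory.setI_int_of_ne _ _ h_bd, e₂ _ h_sb.symm]
  obtain ⟨f₄, run₄, w₄⟩ := runs_iwrite (B := B) (N := N) s₃ (.read 0 (.const 0))
    (.ilt (.const 0) (.read sel (.add (.mul .pid (.read 0 (.const 2))) rnd))) barg
    (blk (.sub (.read sel (.add (.mul .pid (.read 0 (.const 2))) rnd)) (.const 1))) (.const 0)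
    (act := fun q => 0 < f₂ (q * ρ + r)) (addr := fun q => β (f₂ (q * ρ + r) - 1))
    (val := fun _ => 0) (by simpa only [IExpr.eval, e₃0] using hn) hnB hnN
    (fun q _ => by simp only [BExpr.eval, IExpr.eval, hrnd s₃ a3, e₃0, hρ, e₃s])
    (fun q hq ha => by
      have he : (IExpr.sub (.read sel (.add (.mul .pid (.read 0 (.const 2))) rnd))
          (.const 1)).eval s₃ q = f₂ (q * ρ + r) - 1 := by
        simp only [IExpr.eval, hrnd s₃ a3, e₃0, hρ, e₃s]
      rw [hblk s₃ a3 _ _ (by rw [he]; exact hsel q hq ha), he])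
    (fun q _ _ => rfl)
    (fun q hq ha => ⟨((hβ _ (hsel q hq ha)).le).trans hkB, Nat.zero_le _⟩)
  have a4 := a3.setI (a := barg) (by simp) f₄
  set s₄ := s₃.setI barg f₄ with hs₄
  have e₄s : s₄.int sel = f₂ := by simp [hs₄, h_sb, e₃s]
  have e₄0 : s₄.int 0 = s.int 0 := by simp [hs₄, h_b, e₃0]
  have e₄d : s₄.int dead = f₃ := by simp [hs₄, h_bd.symm, hs₃]
  have e₄b : s₄.int barg = f₄ := by simp [hs₄]
  have e₄k : s₄.real key = s.real key := e₁k
  have e₄w : s₄.real selw = f₁ := e₁w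
  rw [show s₂.int dead = s.int dead from e₂ _ h_sd.symm] at w₃
  rw [e₃b] at w₄
  have hpop := popSpec_of_wr hr hbm hγ hβ hβγ hfresh w₁ w₂ w₃
  obtain ⟨hG₁, hG₂⟩ := hG _ _ _ hpop
  -- An emptied block has no current minimum, so an offer to it has nothing to beat.
  have hzero : ∀ e, Popped n ρ r f₂ e → f₄ (β e) = 0 := by
    rintro e ⟨g, hg, he⟩
    rcases w₄ (β e) with ⟨q, -, -, -, hv, -⟩ | ⟨hno, -⟩
    · exact hv
    · exact absurd (by simp [he]) (hno g hg (by omega))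
  have hold : ∀ c, (∀ e, Popped n ρ r f₂ e → β e ≠ c) → f₄ c = s.int barg c := by
    intro c hc
    rcases w₄ c with ⟨q, hq, ha, haddr, -⟩ | ⟨-, ho⟩
    · exact absurd haddr (hc _ ⟨q, hq, (Nat.succ_pred_eq_of_pos ha).symm⟩)
    · exact ho
  obtain ⟨f₅, f₆, run₅, hbm'⟩ := runs_fixCmd (B := B) (N := N) s₄
    (np := .mul (.read 0 (.const 0)) (.read 0 (.const 2))) (guard := guard) (cell := blk elem)
    (elem := elem) (barg := barg) (key := key) (scr := scr) (k := n * ρ) (act := G f₂ f₃)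
    (el := el f₂) (blk := β) (alive := fun e => alive e ∧ ¬ Popped n ρ r f₂ e) h_kc hnρB hnρN
    (fun f => by simp only [IExpr.eval, Memory.setR_int, e₄0, hn, hρ])
    (fun f q _ => by
      rw [hguard _ (a4.setR (by simp) f), Memory.setR_int, e₄s, e₄d])
    (fun f q hq ha => by
      have he := helem _ (a4.setR (a := scr) (by simp) f) q
      rw [Memory.setR_int, e₄s] at he
      rw [hblk _ (a4.setR (by simp) f) _ _ (by rw [he]; exact (hG₁ q hq ha).1.1), he])
    (fun f q hq ha => by
      rw [helem _ (a4.setR (by simp) f), Memory.setR_int, e₄s])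
    (fun e he => ⟨(hβ e he.1).le.trans hkB, heB e he.1⟩)
    (fun c e he => by
      rw [e₄b] at he
      have hnz : ∀ e, Popped n ρ r f₂ e → β e ≠ c := by
        rintro e' he' rfl
        rw [hzero e' he'] at he
        omega
      obtain ⟨h1, h2⟩ := hbm.sound c e ((hold c hnz).symm.trans he)
      exact ⟨⟨h1, fun hp => hnz e hp h2⟩, h2⟩)
    (fun q hq ha => by
      obtain ⟨h1, e', h2, h3⟩ := hG₁ q hq ha
      refine ⟨h1, fun e he => ?_⟩
      rw [e₄b, h3, hzero e' h2] at he
      omega)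
    (fun e he => by
      -- Either the block of `e` was emptied and some processor offers `e`, or its old entry still
      -- bounds `e` from below.
      by_cases hz : ∃ e', Popped n ρ r f₂ e' ∧ β e = β e'
      · obtain ⟨e', h1, h2⟩ := hz
        exact Or.inl (hG₂ e he.1 he.2 e' h1 h2)
      · right
        rw [e₄b, e₄k, hold _ fun e' he' heq => hz ⟨e', he', heq.symm⟩]
        exact hbm.min e he.1)
  have a6 := (a4.setR (a := scr) (by simp) f₅).setI (a := barg) (by simp) f₆
  refine ⟨_, run₁.seq (run₂.seq (run₃.seq (run₄.seq run₅))), a6, ?_, ?_⟩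
  · simpa [h_sb, h_bd.symm, h_wc, e₄s, e₄d, e₄w] using hpop
  · simpa [h_sb, e₄s, e₄k] using hbm'

end PRAM

namespace PRAM

/-! ### Selection of the `ρ` lightest arcs out of every vertex -/

/-- The number of vertices. -/
abbrev nE : IExpr := .read 0 (.const 0)

/-- The number of arcs. -/
abbrev arcsE : IExpr := .mul (.const 2) (.read 0 (.const 1))

/-- The parameter `ρ`. -/
abbrev rhoE : IExpr := .read 0 (.const 2)

/-- The program that increments the counter `k`. -/
def incrCmd (k : ℕ) : Cmd :=
  .iwrite (.const 1) .tt 0 (.const k) (.add (.read 0 (.const k)) (.const 1))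

theorem runs_incrCmd {B N : ℕ} (s : Memory) (k : ℕ) (hB : 1 ≤ B) (hN : 1 ≤ N) (hk : k ≤ B)
    (hs : s.int 0 k + 1 ≤ B) : ∃ f, Runs B N (incrCmd k) s (s.setI 0 f) ∧
      f k = s.int 0 k + 1 ∧ ∀ j, j ≠ k → f j = s.int 0 j := by
  obtain ⟨f, hr, hw⟩ := runs_iwrite (B := B) (N := N) s (.const 1) .tt 0 (.const k)
    (.add (.read 0 (.const k)) (.const 1)) (k := 1) (act := fun _ => True) (addr := fun _ => k)
    (val := fun _ => s.int 0 k + 1) rfl hB hN (fun _ _ => Iff.rfl) (fun _ _ _ => rfl)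
    (fun _ _ _ => rfl) (fun _ _ _ => ⟨hk, hs⟩)
  refine ⟨f, hr, ?_, fun j hj => ?_⟩
  · rcases hw k with ⟨q, -, -, -, hv, -⟩ | ⟨hno, -⟩
    · exact hv
    · exact absurd rfl (hno 0 (by omega) trivial)
  · rcases hw j with ⟨q, -, -, ha, -⟩ | ⟨-, ho⟩
    · exact absurd ha.symm hj
    · exact ho

/-- The block of an arc. -/
def arcBlkE (x : IExpr) : IExpr := .add (.read 2 x) (.div x rhoE)

/-- The arc selected in the current round at the vertex `q / ρ`, plus `1`. -/
def arcSelE : IExpr := .read 5 (.add (.mul (.div .pid rhoE) rhoE) (.read 0 (.const 3)))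

/-- The `q % ρ`-th arc number in the same range of length `ρ` as the selected arc. -/
def arcElemE : IExpr :=
  .add (.mul rhoE (.div (.sub arcSelE (.const 1)) rhoE)) (.mod .pid rhoE)

/-- That number belongs to a live arc with the same tail. -/
def arcGuard : BExpr :=
  .and (.ilt (.const 0) arcSelE) <| .and (.ilt arcElemE arcsE) <|
  .and (.not (.ilt (.read 2 arcElemE) (.div .pid rhoE))) <|
  .and (.not (.ilt (.div .pid rhoE) (.read 2 arcElemE)))
    (.ilt (.read 6 arcElemE) (.const 1))

/-- One round of the selection of light arcs. -/
def arcRound : Cmd :=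
  .seq (popCmd (.add (.add nE (.div arcsE rhoE)) (.const 1)) (.read 0 (.const 3)) 5 7 6 0 3 4
    (fun x => .read 2 x) arcBlkE arcGuard arcElemE) (incrCmd 3)

/-- Block minima of all arcs. -/
def arcInit : Cmd := fixCmd arcsE .tt (arcBlkE .pid) .pid 7 0 4

/-- Selection of the `ρ` lightest arcs out of every vertex. -/
def arcLoop : Cmd := .loop (.ilt (.read 0 (.const 3)) rhoE) arcRound

/-- A memory with `M` arcs grouped by their tails, among `n` vertices. -/
structure ArcInput (n M ρ : ℕ) (s : Memory) : Prop where
  n_eq : s.int 0 0 = n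
  M_eq : 2 * s.int 0 1 = M
  ρ_eq : s.int 0 2 = ρ
  ρ_pos : 0 < ρ
  tail_lt : ∀ e < M, s.int 2 e < n
  head_lt : ∀ e < M, s.int 3 e < n
  mono : ∀ e e', e ≤ e' → e' < M → s.int 2 e ≤ s.int 2 e'
  count : s.int 0 3 = 0 ∧ s.int 0 4 = 0
  zero : ∀ a, 4 ≤ a → s.int a = 0
  rzero : ∀ a, 1 ≤ a → s.real a = 0

/-- The state of the selection before round `r`. -/
structure ArcInv (n M ρ : ℕ) (s₀ : Memory) (r : ℕ) (s : Memory) : Prop where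
  agree : AgreeOff [0, 5, 6, 7] [3, 4] s₀ s
  count : s.int 0 3 = r
  other : ∀ j, j ≠ 3 → s.int 0 j = s₀.int 0 j
  bm : BlockMin (fun e => e < M ∧ s.int 6 e = 0) (s₀.real 0) (fun e => s₀.int 2 e + e / ρ)
    (s.int 7)
  fresh : ∀ u < n, ∀ j, r ≤ j → j < ρ → s.int 5 (u * ρ + j) = 0
  done : ∀ u < n, ∀ j < r,
    (∃ e < M, s.int 5 (u * ρ + j) = e + 1 ∧ s₀.int 2 e = u ∧ s.int 6 e ≠ 0 ∧
      ∀ e' < M, s.int 6 e' = 0 → s₀.int 2 e' = u → s₀.real 0 e ≤ s₀.real 0 e') ∨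
    (s.int 5 (u * ρ + j) = 0 ∧ ∀ e' < M, s.int 6 e' = 0 → s₀.int 2 e' ≠ u)
  listed : ∀ e < M, s.int 6 e ≠ 0 → ∃ j < r, s.int 5 (s₀.int 2 e * ρ + j) = e + 1
  inj : ∀ u < n, ∀ j₁ < r, ∀ j₂ < r, s.int 5 (u * ρ + j₁) = s.int 5 (u * ρ + j₂) →
    s.int 5 (u * ρ + j₁) ≠ 0 → j₁ = j₂

/-- Tails and quotients `e / ρ` are both nondecreasing in `e`, so equality of the sums forces
equality of both terms. Using the sum as the block number, rather than a pair, keeps the number of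
blocks at `n + M / ρ + 1`. -/
theorem ArcInput.blk_inj {n M ρ : ℕ} {s : Memory} (h : ArcInput n M ρ s) {e e' : ℕ} (he : e < M)
    (he' : e' < M) (heq : s.int 2 e + e / ρ = s.int 2 e' + e' / ρ) :
    s.int 2 e = s.int 2 e' ∧ e / ρ = e' / ρ := by
  rcases le_total e e' with hle | hle
  · have h1 := h.mono e e' hle he'
    have h2 := Nat.div_le_div_right (c := ρ) hle
    omega
  · have h1 := h.mono e' e hle he
    have h2 := Nat.div_le_div_right (c := ρ) hle
    omega

/-- All minima start at `0`, so every arc is offered. This single step uses one processor per arc;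
later rounds cannot afford that. -/
theorem arcInit_runs {n M ρ B N : ℕ} {s₀ : Memory} (h : ArcInput n M ρ s₀)
    (hB : n + M + 1 ≤ B) (hN : M ≤ N) :
    ∃ t, Runs B N arcInit s₀ t ∧ ArcInv n M ρ s₀ 0 t := by
  have hz : ∀ a, 4 ≤ a → ∀ c, s₀.int a c = 0 := fun a ha c => by rw [h.zero a ha]; rfl
  obtain ⟨f, g, hrun, hbm⟩ := runs_fixCmd (B := B) (N := N) s₀ (np := arcsE) (guard := .tt)
    (cell := arcBlkE .pid) (elem := .pid) (barg := 7) (key := 0) (scr := 4) (k := M)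
    (act := fun _ => True) (el := id) (blk := fun e => s₀.int 2 e + e / ρ)
    (alive := fun e => e < M) (by decide) (by omega) hN
    (fun f => by simpa only [IExpr.eval, Memory.setR_int] using h.M_eq)
    (fun f q _ => Iff.rfl)
    (fun f q _ _ => by simp only [arcBlkE, IExpr.eval, Memory.setR_int, h.ρ_eq, id])
    (fun f q _ _ => rfl)
    (fun e he => by
      have h1 := h.tail_lt e he
      have h2 := Nat.div_le_self e ρ
      constructor
      · omega
      · omega)
    (fun c e he => by rw [hz 7 (by omega)] at he; omega)
    (fun q hq _ => ⟨hq, fun e he => by rw [hz 7 (by omega)] at he; omega⟩)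
    (fun e he => Or.inl ⟨e, he, trivial, rfl⟩)
  refine ⟨_, hrun, ((AgreeOff.refl _ _ _).setR (by simp) _).setI (by simp) _, ?_, ?_, ?_, ?_, ?_,
    ?_, ?_⟩
  · simpa using h.count.1
  · intro j _; simp
  · simpa [hz 6] using hbm
  · intro u _ j _ _
    simp [hz 5]
  · intro u _ j hj; omega
  · intro e _ h6
    simp [hz 6] at h6
  · intro u _ j hj; omega

theorem sq_index {n ρ u j : ℕ} (hu : u < n) (hj : j < ρ) :
    u * ρ + j < n * ρ ∧ (u * ρ + j) / ρ = u ∧ (u * ρ + j) % ρ = j := by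
  refine ⟨by nlinarith [Nat.mul_le_mul_right ρ (Nat.succ_le_of_lt hu)], ?_, ?_⟩
  · rw [mul_comm, Nat.mul_add_div (by omega), Nat.div_eq_of_lt hj, add_zero]
  · rw [mul_comm, Nat.mul_add_mod, Nat.mod_eq_of_lt hj]

/-- The processor `u * ρ + j` inspects the `j`-th number of the interval containing the arc just
selected at `u`. The guard rejects numbers that are out of range, belong to another tail, or have
been selected. -/
theorem arcRound_runs {n M ρ B N r : ℕ} {s₀ s : Memory} (h : ArcInput n M ρ s₀) (hr : r < ρ)
    (hB : n * ρ + n + M + ρ + 3 ≤ B) (hN : n + M / ρ + 1 + n * ρ ≤ N)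
    (hs : ArcInv n M ρ s₀ r s) :
    ∃ t, Runs B N arcRound s t ∧ ArcInv n M ρ s₀ (r + 1) t := by
  have hρ := h.ρ_pos
  have hMρ := Nat.div_le_self M ρ
  have hN₁ : n + M / ρ + 1 ≤ N := (Nat.le_add_right _ _).trans hN
  have hN₂ : n * ρ ≤ N := (Nat.le_add_left _ _).trans hN
  have hN₃ : n + 1 ≤ N := le_trans (by have := Nat.zero_le (M / ρ); gcongr; simp) hN₁
  have h02 : s.int 0 2 = ρ := by rw [hs.other 2 (by decide), h.ρ_eq]
  have h00 : s.int 0 0 = n := by rw [hs.other 0 (by decide), h.n_eq]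
  have h01 : 2 * s.int 0 1 = M := by rw [hs.other 1 (by decide), h.M_eq]
  have i2 : s.int 2 = s₀.int 2 := hs.agree.1 2 (by decide)
  have r0 : s.real 0 = s₀.real 0 := hs.agree.2 0 (by decide)
  have key : ∀ t, AgreeOff [5, 7, 6] [3, 4] s t → t.int 0 = s.int 0 ∧ t.int 2 = s₀.int 2 :=
    fun t ht => ⟨ht.1 0 (by decide), (ht.1 2 (by decide)).trans i2⟩
  obtain ⟨t, hrun, hag, hpop, hbm⟩ := runs_popCmd (B := B) (N := N) s
    (n := n) (ρ := ρ) (r := r) (k := n + M / ρ + 1)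
    (nb := .add (.add nE (.div arcsE rhoE)) (.const 1)) (rnd := .read 0 (.const 3))
    (sel := 5) (barg := 7) (dead := 6) (key := 0) (selw := 3) (scr := 4)
    (grp := fun x => .read 2 x) (blk := arcBlkE) (guard := arcGuard) (elem := arcElemE)
    (el := fun sel q => ρ * ((sel (q / ρ * ρ + r) - 1) / ρ) + q % ρ)
    (G := fun sel dead q => 0 < sel (q / ρ * ρ + r) ∧
      ρ * ((sel (q / ρ * ρ + r) - 1) / ρ) + q % ρ < M ∧
      ¬ s₀.int 2 (ρ * ((sel (q / ρ * ρ + r) - 1) / ρ) + q % ρ) < q / ρ ∧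
      ¬ q / ρ < s₀.int 2 (ρ * ((sel (q / ρ * ρ + r) - 1) / ρ) + q % ρ) ∧
      dead (ρ * ((sel (q / ρ * ρ + r) - 1) / ρ) + q % ρ) < 1)
    (γ := fun e => s₀.int 2 e) (β := fun e => s₀.int 2 e + e / ρ)
    (alive := fun e => e < M ∧ s.int 6 e = 0)
    (by decide) (by decide) h00 h02 hr (by omega) hN₁ (by omega) (by omega) (by omega) hN₂
    (fun t ht => by simp only [IExpr.eval, (key t ht).1, h00, h01, h02])
    (fun t ht q => by simp only [IExpr.eval, (key t ht).1, hs.count])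
    (fun t ht x q _ => by simp only [IExpr.eval, (key t ht).2])
    (fun t ht x q _ => by simp only [arcBlkE, IExpr.eval, (key t ht).1, (key t ht).2, h02])
    (fun t ht q => by
      simp only [arcElemE, arcSelE, IExpr.eval, (key t ht).1, h02, hs.count])
    (fun t ht q => by
      simp only [arcGuard, arcElemE, arcSelE, IExpr.eval, BExpr.eval, (key t ht).1, (key t ht).2,
        h02, h01, hs.count])
    (by rw [r0]; exact hs.bm)
    (fun e he => h.tail_lt e he.1)
    (fun e he => by
      have h1 := h.tail_lt e he.1
      have h2 := Nat.div_le_div_right (c := ρ) he.1.le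
      omega)
    (fun e e' he he' heq => (h.blk_inj he.1 he'.1 heq).1)
    (fun e he => by have := he.1; omega)
    (fun g hg => hs.fresh g hg r le_rfl hr)
    (by
      intro sel' selw' dead' hp
      constructor
      · rintro q hq ⟨g1, g2, g3, g4, g5⟩
        set e := ρ * ((sel' (q / ρ * ρ + r) - 1) / ρ) + q % ρ with he
        have hqn : q / ρ < n := Nat.div_lt_of_lt_mul (by rwa [mul_comm] at hq)
        have hnp : ¬ Popped n ρ r sel' e := fun hpp => by
          rw [hp.dead_of_popped e hpp] at g5; omega
        refine ⟨⟨⟨g2, ?_⟩, hnp⟩, sel' (q / ρ * ρ + r) - 1, ⟨q / ρ, hqn, by omega⟩, ?_⟩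
        · rw [← hp.dead_of_not e hnp]; omega
        · obtain ⟨⟨h1, -⟩, h2, -⟩ := hp.alive_of_popped hqn
            (show sel' (q / ρ * ρ + r) = sel' (q / ρ * ρ + r) - 1 + 1 by omega)
          have h3 : e / ρ = (sel' (q / ρ * ρ + r) - 1) / ρ := by
            rw [he, Nat.mul_add_div hρ, Nat.div_eq_of_lt (Nat.mod_lt _ hρ), add_zero]
          omega
      · rintro e ⟨he, hd⟩ hnp e' ⟨g, hg, hsel⟩ hblk
        obtain ⟨⟨h1, -⟩, h2, -⟩ := hp.alive_of_popped hg hsel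
        obtain ⟨h3, h4⟩ := h.blk_inj he h1 hblk
        obtain ⟨q1, q2, q3⟩ := sq_index hg (Nat.mod_lt e hρ)
        -- A survivor in the block of the selected arc lies in the same interval, hence is found by
        -- the processor with offset `e % ρ`.
        have hel : ρ * ((sel' (g * ρ + r) - 1) / ρ) + e % ρ = e := by
          rw [hsel, Nat.add_sub_cancel, ← h4, Nat.div_add_mod]
        refine ⟨g * ρ + e % ρ, q1, ?_, ?_⟩ <;> rw [q2, q3, hel]
        refine ⟨by omega, he, ?_, ?_, ?_⟩
        · omega
        · omega
        · rw [hp.dead_of_not e hnp, hd]; omega)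
  obtain ⟨k0, k2⟩ := key t hag
  obtain ⟨f, hrun', hf, hf'⟩ := runs_incrCmd (B := B) (N := N) t 3 (by omega) (by omega)
    (by omega) (by rw [k0, hs.count]; omega)
  rw [k0] at hf hf'
  rw [r0] at hpop hbm
  have hdead : ∀ e, s.int 6 e ≠ 0 → t.int 6 e ≠ 0 := by
    intro e he
    by_cases hp : Popped n ρ r (t.int 5) e
    · rw [hpop.dead_of_popped e hp]; omega
    · rwa [hpop.dead_of_not e hp]
  have hold : ∀ u, ∀ j < ρ, j ≠ r → t.int 5 (u * ρ + j) = s.int 5 (u * ρ + j) :=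
    fun u j hj hne => (hpop.other _ fun g _ heq => hne (mul_add_inj hj hr heq).2).1
  refine ⟨_, hrun.seq hrun', ⟨fun a ha => ?_, fun a ha => ?_⟩, ?_, ?_, ?_, ?_, ?_, ?_, ?_⟩
  · simp only [List.mem_cons, List.not_mem_nil, or_false, not_or] at ha
    rw [Memory.setI_int_of_ne _ _ ha.1, hag.1 a (by simp [ha]), hs.agree.1 a (by simp [ha])]
  · rw [Memory.setI_real, hag.2 a ha, hs.agree.2 a ha]
  · rw [Memory.setI_int_self, hf, hs.count]
  · intro j hj
    rw [Memory.setI_int_self, hf' j hj, hs.other j hj]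
  all_goals simp only [Memory.setI_int_of_ne t f (show 5 ≠ 0 by decide),
    Memory.setI_int_of_ne t f (show 6 ≠ 0 by decide),
    Memory.setI_int_of_ne t f (show 7 ≠ 0 by decide)]
  · convert hbm using 2 with e
    constructor
    · rintro ⟨h1, h2⟩
      have hnp : ¬ Popped n ρ r (t.int 5) e := fun hp => by
        rw [hpop.dead_of_popped e hp] at h2; omega
      exact ⟨⟨h1, by rwa [hpop.dead_of_not e hnp] at h2⟩, hnp⟩
    · rintro ⟨⟨h1, h2⟩, hnp⟩
      exact ⟨h1, by rwa [hpop.dead_of_not e hnp]⟩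
  · intro u hu j hj hjρ
    rw [hold u j hjρ (by omega)]
    exact hs.fresh u hu j (by omega) hjρ
  · intro u hu j hj
    have hmono : ∀ e', t.int 6 e' = 0 → s.int 6 e' = 0 := fun e' h' => by
      by_contra hc
      exact hdead e' hc h'
    rcases Nat.lt_succ_iff_lt_or_eq.1 hj with hj | rfl
    · rw [hold u j (by omega) (by omega)]
      rcases hs.done u hu j hj with ⟨e, h1, h2, h3, h4, h5⟩ | ⟨h1, h2⟩
      · exact Or.inl ⟨e, h1, h2, h3, hdead e h4, fun e' he' hd' => h5 e' he' (hmono e' hd')⟩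
      · exact Or.inr ⟨h1, fun e' he' hd' => h2 e' he' (hmono e' hd')⟩
    · rcases hpop.pop u hu with ⟨e, ⟨h1, h2⟩, h3, h4, h5, h6⟩ | ⟨h1, h2⟩
      · refine Or.inl ⟨e, h1, h4, h3, ?_, fun e' he' hd' => h6 e' ⟨he', hmono e' hd'⟩⟩
        rw [hpop.dead_of_popped e ⟨u, hu, h4⟩]
        omega
      · exact Or.inr ⟨h1, fun e' he' hd' => h2 e' ⟨he', hmono e' hd'⟩⟩
  · intro e he hd
    by_cases hp : Popped n ρ r (t.int 5) e
    · obtain ⟨g, hg, hsel⟩ := hp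
      obtain ⟨-, h2, -⟩ := hpop.alive_of_popped hg hsel
      exact ⟨r, by omega, by rw [h2]; exact hsel⟩
    · rw [hpop.dead_of_not e hp] at hd
      obtain ⟨j, hj, hsel⟩ := hs.listed e he hd
      exact ⟨j, by omega, by rw [hold _ j (by omega) (by omega), hsel]⟩
  · have hnew : ∀ u < n, ∀ j < r, t.int 5 (u * ρ + j) = t.int 5 (u * ρ + r) →
        t.int 5 (u * ρ + j) = 0 := by
      intro u hu j hj heq
      by_contra hne
      obtain ⟨e, he⟩ := Nat.exists_eq_succ_of_ne_zero hne
      obtain ⟨⟨-, h1⟩, -⟩ := hpop.alive_of_popped hu (heq.symm.trans he)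
      rw [hold u j (by omega) (by omega)] at he
      rcases hs.done u hu j hj with ⟨e₁, -, h2, -, h3, -⟩ | ⟨h2, -⟩
      · obtain rfl : e₁ = e := by omega
        exact h3 h1
      · omega
    intro u hu j₁ hj₁ j₂ hj₂ heq hne
    rcases Nat.lt_succ_iff_lt_or_eq.1 hj₁ with hj₁ | rfl
    · rcases Nat.lt_succ_iff_lt_or_eq.1 hj₂ with hj₂ | rfl
      · rw [hold u j₁ (by omega) (by omega)] at heq hne
        rw [hold u j₂ (by omega) (by omega)] at heq
        exact hs.inj u hu j₁ hj₁ j₂ hj₂ heq hne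
      · exact absurd (hnew u hu j₁ hj₁ heq) hne
    · rcases Nat.lt_succ_iff_lt_or_eq.1 hj₂ with hj₂ | rfl
      · exact absurd (heq.trans (hnew u hu j₂ hj₂ heq.symm)) hne
      · rfl

/-- The cells `uρ, …, uρ + ρ - 1` of `list` hold, plus `1`, the `ρ` lightest of the arcs out of
`u`, or all of them and zeros. -/
structure LightArcs (n M ρ : ℕ) (tail : ℕ → ℕ) (w : ℕ → ℝ) (list : ℕ → ℕ) : Prop where
  arc : ∀ u < n, ∀ j < ρ, ∀ e, list (u * ρ + j) = e + 1 → e < M ∧ tail e = u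
  inj : ∀ u < n, ∀ j₁ < ρ, ∀ j₂ < ρ, list (u * ρ + j₁) = list (u * ρ + j₂) →
    list (u * ρ + j₁) ≠ 0 → j₁ = j₂
  light : ∀ e < M, (∃ j < ρ, list (tail e * ρ + j) = e + 1) ∨
    ∀ j < ρ, ∃ e', list (tail e * ρ + j) = e' + 1 ∧ w e' ≤ w e

/-- An arc still alive at the end was a candidate in all `ρ` rounds, so every slot at its tail is
filled with an arc no heavier. -/
theorem ArcInv.lightArcs {n M ρ : ℕ} {s₀ s : Memory} (h : ArcInput n M ρ s₀)
    (hs : ArcInv n M ρ s₀ ρ s) : LightArcs n M ρ (s₀.int 2) (s₀.real 0) (s.int 5) := by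
  refine ⟨fun u hu j hj e he => ?_, hs.inj, fun e he => ?_⟩
  · rcases hs.done u hu j hj with ⟨e', h1, h2, h3, -⟩ | ⟨h1, -⟩
    · obtain rfl : e' = e := by omega
      exact ⟨h1, h3⟩
    · omega
  · by_cases hd : s.int 6 e = 0
    · right
      intro j hj
      rcases hs.done _ (h.tail_lt e he) j hj with ⟨e', h1, h2, h3, -, h5⟩ | ⟨-, h2⟩
      · exact ⟨e', h2, h5 e he hd rfl⟩
      · exact absurd rfl (h2 e he hd)
    · exact Or.inl (hs.listed e he hd)

end PRAM

namespace PRAM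

/-! ### Simultaneous truncated Dijkstra searches

The element `v * n + z` stands for the vertex `z` in the search from `v`. -/

/-- A network given by arcs, with truncated adjacency lists and distances `δ`. -/
structure Net (n M ρ : ℕ) (tail head : ℕ → ℕ) (w : ℕ → ℝ) (list : ℕ → ℕ) (δ : ℕ → ℕ → ℝ) :
    Prop where
  light : LightArcs n M ρ tail w list
  head_lt : ∀ e < M, head e < n
  tail_lt : ∀ e < M, tail e < n
  simple : ∀ e < M, ∀ e' < M, tail e = tail e' → head e = head e' → e = e'
  nonneg : ∀ v z, 0 ≤ δ v z
  self : ∀ v < n, δ v v = 0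
  tri : ∀ v < n, ∀ e < M, δ v (head e) ≤ δ v (tail e) + w e
  exit : ∀ v < n, ∀ S : ℕ → Prop, S v → ∀ x < n, ¬ S x →
    ∃ e < M, S (tail e) ∧ ¬ S (head e) ∧ δ v (tail e) + w e ≤ δ v x

/-- The arc `e` is in the truncated adjacency list of `y`. -/
def InList (ρ : ℕ) (list : ℕ → ℕ) (y e : ℕ) : Prop := ∃ j < ρ, list (y * ρ + j) = e + 1

/-- The element `E` has been reached but not settled. -/
def Live (n : ℕ) (home dead : ℕ → ℕ) (E : ℕ) : Prop := E < n * n ∧ home E ≠ 0 ∧ dead E = 0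

/-- The state of the searches from all vertices when `i` vertices are settled in each. -/
structure SearchInv (n ρ : ℕ) (head : ℕ → ℕ) (w : ℕ → ℝ) (list : ℕ → ℕ) (δ : ℕ → ℕ → ℝ) (i : ℕ)
    (home dead : ℕ → ℕ) (tent : ℕ → ℝ) (sel : ℕ → ℕ) (D : ℕ → ℝ) : Prop where
  fresh : ∀ v < n, ∀ j, i ≤ j → j < ρ → sel (v * ρ + j) = 0
  -- `home` is one more than the round of first reach, and `0` before it. The source shares block
  -- `0` with the vertices reached in round `0`, but it is settled before they are reached; hence
  -- the separate case.
  home_eq : ∀ v < n, ∀ z < n, ∀ b, home (v * n + z) = b + 1 → dead (v * n + z) = 0 →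
    (b < i ∧ ∃ x < n, sel (v * ρ + b) = v * n + x + 1 ∧ ∃ e, InList ρ list x e ∧ head e = z) ∨
      (i = 0 ∧ b = 0 ∧ z = v)
  settled : ∀ v < n, ∀ j < i, ∃ x < n, sel (v * ρ + j) = v * n + x + 1 ∧ D (v * ρ + j) = δ v x ∧
    dead (v * n + x) ≠ 0 ∧ (∀ z < n, dead (v * n + z) = 0 → δ v x ≤ δ v z) ∧
    ∀ e, InList ρ list x e → dead (v * n + head e) = 0 →
      home (v * n + head e) ≠ 0 ∧ tent (v * n + head e) ≤ δ v x + w e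
  listed : ∀ v < n, ∀ z < n, dead (v * n + z) ≠ 0 → ∃ j < i, sel (v * ρ + j) = v * n + z + 1
  inj : ∀ v < n, ∀ j₁ < i, ∀ j₂ < i, sel (v * ρ + j₁) = sel (v * ρ + j₂) → j₁ = j₂
  mono : ∀ v < n, ∀ j < i, ∀ k < i, j ≤ k → D (v * ρ + j) ≤ D (v * ρ + k)
  le_tent : ∀ v < n, ∀ z < n, Live n home dead (v * n + z) → δ v z ≤ tent (v * n + z)
  source : ∀ v < n, (i = 0 ∧ home (v * n + v) ≠ 0 ∧ tent (v * n + v) = 0) ∨ dead (v * n + v) ≠ 0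

section

variable {n M ρ : ℕ} {tail head : ℕ → ℕ} {w : ℕ → ℝ} {list : ℕ → ℕ} {δ : ℕ → ℕ → ℝ} {i : ℕ}
  {home dead : ℕ → ℕ} {tent : ℕ → ℝ} {sel : ℕ → ℕ} {D : ℕ → ℝ}

theorem elem_split {E : ℕ} (hE : E < n * n) : E / n < n ∧ E % n < n ∧ E / n * n + E % n = E := by
  have hn : 0 < n := Nat.pos_of_ne_zero (by rintro rfl; simp at hE)
  exact ⟨Nat.div_lt_of_lt_mul hE, Nat.mod_lt _ hn, by rw [mul_comm]; exact Nat.div_add_mod E n⟩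

/-- Every unsettled vertex is at least as far as some reached one. -/
theorem SearchInv.exists_live (hN : Net n M ρ tail head w list δ)
    (h : SearchInv n ρ head w list δ i home dead tent sel D) (hi : i < ρ) {v z : ℕ} (hv : v < n)
    (hz : z < n) (hd : dead (v * n + z) = 0) :
    ∃ y < n, Live n home dead (v * n + y) ∧ tent (v * n + y) ≤ δ v z := by
  rcases h.source v hv with ⟨hi0, h1, h2⟩ | hsrc
  · refine ⟨v, hv, ⟨(sq_index hv hv).1, h1, ?_⟩, h2.trans_le (hN.nonneg v z)⟩
    by_contra hc
    obtain ⟨j, hj, -⟩ := h.listed v hv v hv hc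
    omega
  -- The arc by which a path to `z` leaves the settled set.
  · obtain ⟨e, he, h1, h2, h3⟩ := hN.exit v hv (fun x => dead (v * n + x) ≠ 0) hsrc z hz
      (not_not.2 hd)
    have hlive : ∀ e', InList ρ list (tail e) e' → dead (v * n + head e') = 0 →
        Live n home dead (v * n + head e') ∧
          tent (v * n + head e') ≤ δ v (tail e) + w e' := by
      intro e' hin hd'
      obtain ⟨j, hj, hsel⟩ := h.listed v hv _ (hN.tail_lt e he) h1
      obtain ⟨x, hx, h4, -, -, -, h5⟩ := h.settled v hv j hj
      obtain rfl : x = tail e := by omega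
      obtain ⟨h6, h7⟩ := h5 e' hin hd'
      obtain ⟨j', hj', hl⟩ := hin
      exact ⟨⟨(sq_index hv (hN.head_lt _ (hN.light.arc _ (hN.tail_lt e he) j' hj' e' hl).1)).1,
        h6, hd'⟩, h7⟩
    rcases hN.light.light e he with hin | hall
    · obtain ⟨h4, h5⟩ := hlive e hin (not_not.1 h2)
      exact ⟨_, hN.head_lt e he, h4, h5.trans h3⟩
    -- The exit arc was cut off by the truncation, so the list of its tail is full of arcs no
    -- heavier. If no candidate were good enough, the heads of all these arcs would be settled.
    · choose! f hf using hall
      have harc := fun j hj => hN.light.arc _ (hN.tail_lt e he) j hj _ (hf j hj).1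
      by_contra! hcon
      have hdead : ∀ j < ρ, dead (v * n + head (f j)) ≠ 0 := by
        intro j hj hd'
        obtain ⟨h4, h5⟩ := hlive (f j) ⟨j, hj, (hf j hj).1⟩ hd'
        have := hcon _ (hN.head_lt _ (harc j hj).1) h4
        have := (hf j hj).2
        linarith
      have hpos : ∀ j < ρ, ∃ k < i, sel (v * ρ + k) = v * n + head (f j) + 1 := fun j hj =>
        h.listed v hv _ (hN.head_lt _ (harc j hj).1) (hdead j hj)
      choose! g hg using hpos
      -- The heads are distinct because the graph is simple, and distinct settled vertices occupy
      -- distinct slots; so `ρ` heads would fit into `i < ρ` slots.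
      have hcard : (Finset.range ρ).card ≤ (Finset.range i).card := by
        refine Finset.card_le_card_of_injOn g (fun j hj => ?_) fun j hj j' hj' heq => ?_
        · simpa using (hg j (by simpa using hj)).1
        · simp only [Finset.coe_range, Set.mem_Iio] at hj hj'
          have h4 := (hg j hj).2
          rw [heq, (hg j' hj').2] at h4
          have h5 := hN.simple _ (harc j hj).1 _ (harc j' hj').1
            ((harc j hj).2.trans (harc j' hj').2.symm) (by omega)
          refine hN.light.inj _ (hN.tail_lt e he) j hj j' hj' ?_ ?_
          · rw [(hf j hj).1, (hf j' hj').1, h5]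
          · rw [(hf j hj).1]; omega
      simp at hcard
      omega

/-- Settled vertices occupy distinct slots among the first `i < n`. -/
theorem SearchInv.exists_unsettled (h : SearchInv n ρ head w list δ i home dead tent sel D)
    (hi : i < n) {v : ℕ} (hv : v < n) : ∃ z < n, dead (v * n + z) = 0 := by
  by_contra! hcon
  have hpos : ∀ z < n, ∃ k < i, sel (v * ρ + k) = v * n + z + 1 := fun z hz =>
    h.listed v hv z hz (hcon z hz)
  choose! g hg using hpos
  have hcard : (Finset.range n).card ≤ (Finset.range i).card := by
    refine Finset.card_le_card_of_injOn g (fun j hj => ?_) fun j hj j' hj' heq => ?_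
    · simpa using (hg j (by simpa using hj)).1
    · simp only [Finset.coe_range, Set.mem_Iio] at hj hj'
      have h4 := (hg j hj).2
      rw [heq, (hg j' hj').2] at h4
      omega
  simp at hcard
  omega

variable {dead' : ℕ → ℕ} {sel' : ℕ → ℕ} {D' : ℕ → ℝ}

/-- In every search a nearest unsettled vertex is selected, with its distance. -/
theorem SearchInv.pop (hN : Net n M ρ tail head w list δ)
    (h : SearchInv n ρ head w list δ i home dead tent sel D) (hi : i < ρ) (hρ : ρ ≤ n)
    (hp : PopSpec n ρ i (Live n home dead) tent (fun E => E / n) sel D dead sel' D' dead')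
    {v : ℕ} (hv : v < n) : ∃ y < n, Live n home dead (v * n + y) ∧
      sel' (v * ρ + i) = v * n + y + 1 ∧ D' (v * ρ + i) = δ v y ∧
      ∀ z < n, dead (v * n + z) = 0 → δ v y ≤ δ v z := by
  rcases hp.pop v hv with ⟨E, h1, h2, h3, h4, h5⟩ | ⟨-, hno⟩
  · obtain ⟨-, hy, hE⟩ := elem_split h1.1
    rw [h2] at hE
    have hmin : ∀ z < n, dead (v * n + z) = 0 → tent E ≤ δ v z := by
      intro z hz hd
      obtain ⟨y, hy', hl, ht⟩ := h.exists_live hN hi hv hz hd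
      exact (h5 _ hl (sq_index hv hy').2.1).trans ht
    have hlive : Live n home dead (v * n + E % n) := hE.symm ▸ h1
    -- The selected vertex is itself unsettled, so `hmin` applied to it bounds its tentative
    -- distance by its true distance; `le_tent` gives the converse.
    have heq : tent E = δ v (E % n) := le_antisymm (hmin _ hy hlive.2.2)
      ((h.le_tent v hv _ hy hlive).trans_eq (by rw [hE]))
    exact ⟨E % n, hy, hlive, by rw [h3, hE], h4.trans heq, fun z hz hd => heq ▸ hmin z hz hd⟩
  · obtain ⟨z, hz, hd⟩ := h.exists_unsettled (hi.trans_le hρ) hv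
    obtain ⟨y, hy, hl, -⟩ := h.exists_live hN hi hv hz hd
    exact absurd (sq_index hv hy).2.1 (hno _ hl)

/-- The arc, plus `1`, that the processor `q` relaxes in round `i`. -/
def relaxArc (n ρ : ℕ) (list sel : ℕ → ℕ) (i q : ℕ) : ℕ :=
  list ((sel (q / ρ * ρ + i) - 1) % n * ρ + q % ρ)

/-- The element that the processor `q` relaxes in round `i`. -/
def relaxElem (n ρ : ℕ) (head list sel : ℕ → ℕ) (i q : ℕ) : ℕ :=
  q / ρ * n + head (relaxArc n ρ list sel i q - 1)

/-- The processor `q` has found a shorter path. -/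
def RelaxAct (n ρ : ℕ) (head : ℕ → ℕ) (w : ℕ → ℝ) (list : ℕ → ℕ) (i : ℕ) (home : ℕ → ℕ)
    (tent : ℕ → ℝ) (sel : ℕ → ℕ) (D : ℕ → ℝ) (dead : ℕ → ℕ) (q : ℕ) : Prop :=
  0 < relaxArc n ρ list sel i q ∧ dead (relaxElem n ρ head list sel i q) < 1 ∧
    ¬ (¬ home (relaxElem n ρ head list sel i q) < 1 ∧
      ¬ D (q / ρ * ρ + i) + w (relaxArc n ρ list sel i q - 1) <
        tent (relaxElem n ρ head list sel i q))

/-- The processor `q` has reached a vertex for the first time. -/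
def ReachAct (n ρ : ℕ) (head list : ℕ → ℕ) (i : ℕ) (home sel dead : ℕ → ℕ) (q : ℕ) : Prop :=
  0 < relaxArc n ρ list sel i q ∧ dead (relaxElem n ρ head list sel i q) < 1 ∧
    home (relaxElem n ρ head list sel i q) < 1

/-- The effect of relaxing the list of the vertex `y` on the vertex `z` in the search from `v`. -/
structure Relaxed (n ρ : ℕ) (head : ℕ → ℕ) (w : ℕ → ℝ) (list : ℕ → ℕ) (δ : ℕ → ℕ → ℝ) (i : ℕ)
    (home dead : ℕ → ℕ) (tent : ℕ → ℝ) (home' : ℕ → ℕ) (tent' : ℕ → ℝ) (v y z : ℕ) : Prop where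
  tent_or : tent' (v * n + z) = tent (v * n + z) ∨ ∃ e, InList ρ list y e ∧ head e = z ∧
    dead (v * n + z) = 0 ∧ tent' (v * n + z) = δ v y + w e
  tent_le : home (v * n + z) ≠ 0 → tent' (v * n + z) ≤ tent (v * n + z)
  relaxed : ∀ e, InList ρ list y e → head e = z → dead (v * n + z) = 0 →
    home' (v * n + z) ≠ 0 ∧ tent' (v * n + z) ≤ δ v y + w e
  home_of : home (v * n + z) ≠ 0 → home' (v * n + z) = home (v * n + z)
  reached : home (v * n + z) = 0 → home' (v * n + z) ≠ 0 → home' (v * n + z) = i + 1 ∧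
    (∃ e, InList ρ list y e ∧ head e = z) ∧ ∃ e, InList ρ list y e ∧ head e = z ∧
      tent' (v * n + z) = δ v y + w e
  untouched : (∀ e, InList ρ list y e → head e ≠ z) →
    home' (v * n + z) = home (v * n + z) ∧ tent' (v * n + z) = tent (v * n + z)

/-- Only processors with `q / ρ = v` address elements of the search from `v`, so the two global
writes split into independent statements for each `v` and `z`. Both guards refer to the old `home`:
at a first reach the stored tentative distance is meaningless and is overwritten unconditionally. -/
theorem relaxed_of_wr (hN : Net n M ρ tail head w list δ) {home' : ℕ → ℕ} {tent' : ℕ → ℝ}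
    {y : ℕ → ℕ} (hy : ∀ v < n, y v < n ∧ sel' (v * ρ + i) = v * n + y v + 1 ∧
      D' (v * ρ + i) = δ v (y v))
    (h₁ : Wr (n * ρ) (RelaxAct n ρ head w list i home tent sel' D' dead')
      (relaxElem n ρ head list sel' i)
      (fun q => D' (q / ρ * ρ + i) + w (relaxArc n ρ list sel' i q - 1)) tent tent')
    (h₂ : Wr (n * ρ) (ReachAct n ρ head list i home sel' dead')
      (relaxElem n ρ head list sel' i) (fun _ => i + 1) home home')
    {v z : ℕ} (hv : v < n) (hz : z < n) :
    Relaxed n ρ head w list δ i home dead' tent home' tent' v (y v) z := by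
  have hfwd : ∀ q < n * ρ, 0 < relaxArc n ρ list sel' i q →
      relaxElem n ρ head list sel' i q = v * n + z →
      q / ρ = v ∧ InList ρ list (y v) (relaxArc n ρ list sel' i q - 1) ∧
        head (relaxArc n ρ list sel' i q - 1) = z := by
    intro q hq ha he
    have hqv : q / ρ < n := Nat.div_lt_of_lt_mul (by rwa [mul_comm] at hq)
    have hρ : 0 < ρ := Nat.pos_of_ne_zero (by rintro rfl; simp at hq)
    have hl : list (y (q / ρ) * ρ + q % ρ) = relaxArc n ρ list sel' i q - 1 + 1 := by
      rw [Nat.sub_add_cancel ha, relaxArc, (hy _ hqv).2.1, Nat.add_sub_cancel,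
        (sq_index hqv (hy _ hqv).1).2.2]
    have hlt := hN.head_lt _ (hN.light.arc _ (hy _ hqv).1 _ (Nat.mod_lt q hρ) _ hl).1
    obtain ⟨h3, h4⟩ := mul_add_inj hlt hz he
    exact ⟨h3, ⟨q % ρ, Nat.mod_lt q hρ, h3 ▸ hl⟩, h4⟩
  have hbwd : ∀ e, InList ρ list (y v) e → head e = z → ∃ q < n * ρ, q / ρ = v ∧
      relaxArc n ρ list sel' i q = e + 1 ∧ relaxElem n ρ head list sel' i q = v * n + z := by
    rintro e ⟨j, hj, hl⟩ rfl
    obtain ⟨q1, q2, q3⟩ := sq_index hv hj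
    have hr : relaxArc n ρ list sel' i (v * ρ + j) = e + 1 := by
      rw [relaxArc, q2, q3, (hy v hv).2.1, Nat.add_sub_cancel, (sq_index hv (hy v hv).1).2.2, hl]
    exact ⟨v * ρ + j, q1, q2, hr, by rw [relaxElem, hr, q2, Nat.add_sub_cancel]⟩
  have hT := h₁ (v * n + z)
  have hH := h₂ (v * n + z)
  have hvD := (hy v hv).2.2
  have hT' : (∃ e, InList ρ list (y v) e ∧ head e = z ∧ dead' (v * n + z) = 0 ∧
        tent' (v * n + z) = δ v (y v) + w e ∧
        (home (v * n + z) ≠ 0 → tent' (v * n + z) < tent (v * n + z)) ∧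
        ∀ e₂, InList ρ list (y v) e₂ → head e₂ = z → tent' (v * n + z) ≤ δ v (y v) + w e₂) ∨
      (tent' (v * n + z) = tent (v * n + z) ∧ ∀ e, InList ρ list (y v) e → head e = z →
        dead' (v * n + z) = 0 → home (v * n + z) ≠ 0 ∧
          tent (v * n + z) ≤ δ v (y v) + w e) := by
    rcases hT with ⟨q, hq, ⟨ha, hd, ho⟩, haddr, hval, hmin⟩ | ⟨hno, hold⟩
    · left
      obtain ⟨h3, h4, h5⟩ := hfwd q hq ha haddr
      dsimp only at hval
      rw [haddr] at hd ho
      rw [h3, hvD] at hval ho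
      have hd0 : dead' (v * n + z) = 0 := by omega
      have hlt : home (v * n + z) ≠ 0 → tent' (v * n + z) < tent (v * n + z) := by
        intro hne
        by_contra hc
        exact ho ⟨by omega, by rwa [← hval]⟩
      refine ⟨_, h4, h5, hd0, hval, hlt, fun e₂ hin₂ he₂ => ?_⟩
      obtain ⟨q', hq', g1, g2, g3⟩ := hbwd e₂ hin₂ he₂
      by_cases hact : RelaxAct n ρ head w list i home tent sel' D' dead' q'
      · have := hmin q' hq' hact g3
        dsimp only at this
        rw [h3, hvD, g1, hvD, g2, Nat.add_sub_cancel] at this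
        exact hval.trans_le this
      -- An inactive processor offers no improvement on the old tentative distance, and the new one
      -- is smaller still.
      · unfold RelaxAct at hact
        rw [g1, hvD, g2, g3, Nat.add_sub_cancel] at hact
        push Not at hact
        obtain ⟨g4, g5⟩ := hact (by omega) (by omega)
        exact (hlt (by omega)).le.trans g5
    · right
      refine ⟨hold, fun e hin he hd => ?_⟩
      obtain ⟨q', hq', g1, g2, g3⟩ := hbwd e hin he
      have hact : ¬ RelaxAct n ρ head w list i home tent sel' D' dead' q' :=
        fun ha => hno q' hq' ha g3
      unfold RelaxAct at hact
      rw [g1, hvD, g2, g3, Nat.add_sub_cancel] at hact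
      push Not at hact
      obtain ⟨g4, g5⟩ := hact (by omega) (by omega)
      exact ⟨by omega, g5⟩
  have hH' : (home (v * n + z) = 0 ∧ home' (v * n + z) = i + 1 ∧ dead' (v * n + z) = 0 ∧
        ∃ e, InList ρ list (y v) e ∧ head e = z) ∨
      (home' (v * n + z) = home (v * n + z) ∧ ∀ e, InList ρ list (y v) e → head e = z →
        dead' (v * n + z) = 0 → home (v * n + z) ≠ 0) := by
    rcases hH with ⟨q, hq, ⟨ha, hd, ho⟩, haddr, hval, -⟩ | ⟨hno, hold⟩
    · left
      obtain ⟨h3, h4, h5⟩ := hfwd q hq ha haddr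
      rw [haddr] at hd ho
      exact ⟨by omega, hval, by omega, _, h4, h5⟩
    · right
      refine ⟨hold, fun e hin he hd h0 => ?_⟩
      obtain ⟨q', hq', g1, g2, g3⟩ := hbwd e hin he
      exact hno q' hq' ⟨by omega, by rw [g3]; omega, by rw [g3]; omega⟩ g3
  refine ⟨?_, ?_, ?_, ?_, ?_, ?_⟩
  · rcases hT' with ⟨e, h1, h2, h3, h4, -⟩ | ⟨h1, -⟩
    · exact Or.inr ⟨e, h1, h2, h3, h4⟩
    · exact Or.inl h1
  · rcases hT' with ⟨e, h1, h2, h3, h4, h5, -⟩ | ⟨h1, -⟩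
    · exact fun hne => (h5 hne).le
    · exact fun _ => h1.le
  · intro e hin he hd
    constructor
    · rcases hH' with ⟨-, h1, -⟩ | ⟨h1, h2⟩
      · omega
      · rw [h1]; exact h2 e hin he hd
    · rcases hT' with ⟨-, -, -, -, -, -, h6⟩ | ⟨h1, h2⟩
      · exact h6 e hin he
      · exact h1.trans_le (h2 e hin he hd).2
  · intro hne
    rcases hH' with ⟨h1, -⟩ | ⟨h1, -⟩
    · exact absurd h1 hne
    · exact h1
  · intro h0 h0'
    rcases hH' with ⟨-, h1, hd, e, hin, he⟩ | ⟨h1, -⟩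
    · refine ⟨h1, ⟨e, hin, he⟩, ?_⟩
      rcases hT' with ⟨e', h1, h2, -, h4, -⟩ | ⟨-, h2⟩
      · exact ⟨e', h1, h2, h4⟩
      · exact absurd h0 (h2 e hin he hd).1
    · exact absurd (h1.trans h0) h0'
  · intro hno
    constructor
    · rcases hH' with ⟨-, -, -, e, hin, he⟩ | ⟨h1, -⟩
      · exact absurd he (hno e hin)
      · exact h1
    · rcases hT' with ⟨e, hin, he, -⟩ | ⟨h1, -⟩
      · exact absurd he (hno e hin)
      · exact h1

/-- The Dijkstra step. Arcs of the newly settled vertex are relaxed; for the others the old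
estimates persist, since tentative distances of reached vertices only drop. Each new estimate is a
true distance plus an arc weight, so the triangle inequality keeps it above the distance. -/
theorem SearchInv.step (hN : Net n M ρ tail head w list δ)
    (h : SearchInv n ρ head w list δ i home dead tent sel D) (hi : i < ρ)
    (hp : PopSpec n ρ i (Live n home dead) tent (fun E => E / n) sel D dead sel' D' dead')
    {y : ℕ → ℕ} (hy : ∀ v < n, y v < n ∧ Live n home dead (v * n + y v) ∧
      sel' (v * ρ + i) = v * n + y v + 1 ∧ D' (v * ρ + i) = δ v (y v) ∧
      ∀ z < n, dead (v * n + z) = 0 → δ v (y v) ≤ δ v z)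
    {home' : ℕ → ℕ} {tent' : ℕ → ℝ}
    (hrel : ∀ v < n, ∀ z < n,
      Relaxed n ρ head w list δ i home dead' tent home' tent' v (y v) z) :
    SearchInv n ρ head w list δ (i + 1) home' dead' tent' sel' D' := by
  have hpop : ∀ v < n, ∀ z < n, (Popped n ρ i sel' (v * n + z) ↔ z = y v) := by
    intro v hv z hz
    constructor
    · rintro ⟨g, hg, hs⟩
      have h1 := (hy g hg).2.2.1
      obtain ⟨h2, h3⟩ := mul_add_inj (g := g) (g' := v) (hy g hg).1 hz (by omega)
      rw [← h3, h2]
    · rintro rfl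
      exact ⟨v, hv, (hy v hv).2.2.1⟩
  have hdead : ∀ v < n, ∀ z < n, dead' (v * n + z) = 0 → dead (v * n + z) = 0 ∧ z ≠ y v := by
    intro v hv z hz hd
    have hnp : ¬ Popped n ρ i sel' (v * n + z) := fun hpp => by
      rw [hp.dead_of_popped _ hpp] at hd; omega
    exact ⟨by rwa [← hp.dead_of_not _ hnp], fun he => hnp ((hpop v hv z hz).2 he)⟩
  have hdy : ∀ v < n, dead' (v * n + y v) = 1 := fun v hv =>
    hp.dead_of_popped _ ((hpop v hv _ (hy v hv).1).2 rfl)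
  have hdead_ne : ∀ v < n, ∀ z < n, dead (v * n + z) ≠ 0 → dead' (v * n + z) ≠ 0 :=
    fun v hv z hz hne hd => hne (hdead v hv z hz hd).1
  have hold : ∀ v, ∀ j < ρ, j ≠ i → sel' (v * ρ + j) = sel (v * ρ + j) ∧
      D' (v * ρ + j) = D (v * ρ + j) :=
    fun v j hj hne => hp.other _ fun g _ heq => hne (mul_add_inj hj hi heq).2
  have hhead : ∀ x < n, ∀ e, InList ρ list x e → e < M ∧ tail e = x ∧ head e < n := by
    rintro x hx e ⟨j, hj, hl⟩
    obtain ⟨h1, h2⟩ := hN.light.arc x hx j hj e hl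
    exact ⟨h1, h2, hN.head_lt e h1⟩
  refine ⟨?_, ?_, ?_, ?_, ?_, ?_, ?_, ?_⟩
  · intro v hv j hj hjρ
    rw [(hold v j hjρ (by omega)).1]
    exact h.fresh v hv j (by omega) hjρ
  · intro v hv z hz b hb hd
    obtain ⟨hd0, hzy⟩ := hdead v hv z hz hd
    left
    by_cases h0 : home (v * n + z) = 0
    · obtain ⟨h1, h2, -⟩ := (hrel v hv z hz).reached h0 (by omega)
      obtain rfl : b = i := by omega
      exact ⟨by omega, y v, (hy v hv).1, (hy v hv).2.2.1, h2⟩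
    · rw [(hrel v hv z hz).home_of h0] at hb
      rcases h.home_eq v hv z hz b hb hd0 with ⟨h1, x, hx, h2, h3⟩ | ⟨h1, h2, h3⟩
      · exact ⟨by omega, x, hx, by rw [(hold v b (by omega) (by omega)).1, h2], h3⟩
      · exfalso
        rcases (h.home_eq v hv (y v) (hy v hv).1 (home (v * n + y v) - 1)
          (by have := (hy v hv).2.1.2.1; omega) (hy v hv).2.1.2.2) with ⟨h4, -⟩ | ⟨-, -, h5⟩
        · omega
        · exact hzy (h3.trans h5.symm)
  · intro v hv j hj
    rcases Nat.lt_succ_iff_lt_or_eq.1 hj with hj | rfl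
    · obtain ⟨x, hx, h1, h2, h3, h4, h5⟩ := h.settled v hv j hj
      obtain ⟨o1, o2⟩ := hold v j (by omega) (by omega)
      refine ⟨x, hx, o1.trans h1, o2.trans h2, hdead_ne v hv x hx h3,
        fun z hz hd => h4 z hz (hdead v hv z hz hd).1, fun e he hd => ?_⟩
      have hlt := (hhead x hx e he).2.2
      obtain ⟨h6, h7⟩ := h5 e he (hdead v hv _ hlt hd).1
      have hr := hrel v hv _ hlt
      exact ⟨by rw [hr.home_of h6]; exact h6, (hr.tent_le h6).trans h7⟩
    · obtain ⟨h1, h2, h3, h4, h5⟩ := hy v hv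
      refine ⟨y v, h1, h3, h4, by rw [hdy v hv]; omega,
        fun z hz hd => h5 z hz (hdead v hv z hz hd).1, fun e he hd => ?_⟩
      exact (hrel v hv _ (hhead _ h1 e he).2.2).relaxed e he rfl hd
  · intro v hv z hz hd
    by_cases hzy : z = y v
    · subst hzy
      exact ⟨i, by omega, (hy v hv).2.2.1⟩
    · rw [hp.dead_of_not _ fun hpp => hzy ((hpop v hv z hz).1 hpp)] at hd
      obtain ⟨j, hj, hs⟩ := h.listed v hv z hz hd
      exact ⟨j, by omega, by rw [(hold v j (by omega) (by omega)).1, hs]⟩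
  · have hnew : ∀ v < n, ∀ j < i, sel' (v * ρ + j) ≠ sel' (v * ρ + i) := by
      intro v hv j hj heq
      obtain ⟨x, hx, h1, h2, h3, -⟩ := h.settled v hv j hj
      rw [(hold v j (by omega) (by omega)).1, h1, (hy v hv).2.2.1] at heq
      obtain rfl : x = y v := by omega
      exact h3 (hy v hv).2.1.2.2
    intro v hv j₁ hj₁ j₂ hj₂ heq
    rcases Nat.lt_succ_iff_lt_or_eq.1 hj₁ with hj₁ | rfl
    · rcases Nat.lt_succ_iff_lt_or_eq.1 hj₂ with hj₂ | rfl
      · rw [(hold v j₁ (by omega) (by omega)).1, (hold v j₂ (by omega) (by omega)).1] at heq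
        exact h.inj v hv j₁ hj₁ j₂ hj₂ heq
      · exact absurd heq (hnew v hv j₁ hj₁)
    · rcases Nat.lt_succ_iff_lt_or_eq.1 hj₂ with hj₂ | rfl
      · exact absurd heq.symm (hnew v hv j₂ hj₂)
      · rfl
  · intro v hv j hj k hk hjk
    rcases Nat.lt_succ_iff_lt_or_eq.1 hk with hk | rfl
    · rw [(hold v j (by omega) (by omega)).2, (hold v k (by omega) (by omega)).2]
      exact h.mono v hv j (by omega) k hk hjk
    · rcases hjk.lt_or_eq with hjk | rfl
      · obtain ⟨x, -, -, h2, -, h4, -⟩ := h.settled v hv j hjk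
        obtain ⟨g1, g2, -, g3, -⟩ := hy v hv
        rw [(hold v j (by omega) (by omega)).2, h2, g3]
        exact h4 _ g1 g2.2.2
      · exact le_rfl
  · rintro v hv z hz ⟨hlt, hh, hd⟩
    have hr := hrel v hv z hz
    have hcase : ∀ e, InList ρ list (y v) e → head e = z → δ v z ≤ δ v (y v) + w e := by
      rintro e hin rfl
      obtain ⟨h1, h2, -⟩ := hhead _ (hy v hv).1 e hin
      rw [← h2]
      exact hN.tri v hv e h1
    by_cases h0 : home (v * n + z) = 0
    · obtain ⟨-, -, e, h1, h2, h3⟩ := hr.reached h0 hh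
      rw [h3]
      exact hcase e h1 h2
    · rcases hr.tent_or with h1 | ⟨e, h1, h2, -, h3⟩
      · rw [h1]
        exact h.le_tent v hv z hz ⟨hlt, h0, (hdead v hv z hz hd).1⟩
      · rw [h3]
        exact hcase e h1 h2
  · intro v hv
    right
    rcases h.source v hv with ⟨h1, h2, h3⟩ | h1
    -- In round `0` no vertex but the source can have been reached.
    · have : y v = v := by
        obtain ⟨g1, g2, -⟩ := hy v hv
        rcases (h.home_eq v hv (y v) g1 (home (v * n + y v) - 1)
          (by have := g2.2.1; omega) g2.2.2) with ⟨h4, -⟩ | ⟨-, -, h5⟩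
        · omega
        · exact h5
      have := hdy v hv
      simp_all
    · exact hdead_ne v hv v hv h1

end

end PRAM

/-! ### The program of the searches -/

namespace PRAM

/-- The vertex of the search that the processor belongs to. -/
def procE : IExpr := .div .pid rhoE

/-- The element, plus `1`, selected in the current round. -/
def curE : IExpr := .read 11 (.add (.mul procE rhoE) (.read 0 (.const 4)))

/-- The block of an element. -/
def elemBlkE (x : IExpr) : IExpr :=
  .add (.mul (.div x nE) rhoE) (.sub (.read 8 x) (.const 1))

/-- The arc, plus `1`, from the list of the vertex that has created the block of the selected
element. -/
def popArcE : IExpr :=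
  .read 5 (.add (.mul (.mod (.sub (.read 11 (.add (.mul procE rhoE)
    (.sub (.read 8 (.sub curE (.const 1))) (.const 1)))) (.const 1)) nE) rhoE) (.mod .pid rhoE))

/-- The element of the head of that arc. -/
def popElemE : IExpr := .add (.mul procE nE) (.read 3 (.sub popArcE (.const 1)))

/-- That element is live and belongs to the block of the selected one. -/
def popGuard : BExpr :=
  .and (.ilt (.const 0) curE) <| .and (.ilt (.const 0) popArcE) <|
  .and (.ilt (.read 9 popElemE) (.const 1)) <|
  .and (.not (.ilt (.read 8 popElemE) (.read 8 (.sub curE (.const 1)))))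
    (.not (.ilt (.read 8 (.sub curE (.const 1))) (.read 8 popElemE)))

/-- The arc, plus `1`, to be relaxed. -/
def relaxArcE : IExpr :=
  .read 5 (.add (.mul (.mod (.sub curE (.const 1)) nE) rhoE) (.mod .pid rhoE))

/-- The element of its head. -/
def relaxElemE : IExpr := .add (.mul procE nE) (.read 3 (.sub relaxArcE (.const 1)))

/-- The length of the path that ends with this arc. -/
def relaxLenE : RExpr :=
  .add (.read 1 (.add (.mul procE rhoE) (.read 0 (.const 4)))) (.read 0 (.sub relaxArcE (.const 1)))

/-- Relaxation of the tentative distances. -/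
def tentCmd : Cmd :=
  .rwrite (.mul nE rhoE)
    (.and (.ilt (.const 0) relaxArcE) <| .and (.ilt (.read 9 relaxElemE) (.const 1)) <|
      .not (.and (.not (.ilt (.read 8 relaxElemE) (.const 1)))
        (.not (.rlt relaxLenE (.read 5 relaxElemE)))))
    5 relaxElemE relaxLenE

/-- Assignment of blocks to the elements reached for the first time. -/
def homeCmd : Cmd :=
  .iwrite (.mul nE rhoE)
    (.and (.ilt (.const 0) relaxArcE) <| .and (.ilt (.read 9 relaxElemE) (.const 1)) <|
      .ilt (.read 8 relaxElemE) (.const 1))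
    8 relaxElemE (.add (.read 0 (.const 4)) (.const 1))

/-- The head of the relaxed arc is live and beats the minimum of its block. -/
def relaxGuard : BExpr :=
  .and (.ilt (.const 0) relaxArcE) <| .and (.ilt (.read 9 relaxElemE) (.const 1)) <|
  .not (.and (.not (.ilt (.read 10 (elemBlkE relaxElemE)) (.const 1)))
    (.not (.rlt (.read 5 relaxElemE)
      (.read 5 (.sub (.read 10 (elemBlkE relaxElemE)) (.const 1))))))

/-- One round of all searches. -/
def searchRound : Cmd :=
  .seq (popCmd (.mul nE rhoE) (.read 0 (.const 4)) 11 10 9 5 1 6 (fun x => .div x nE) elemBlkE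
    popGuard popElemE) <|
  .seq tentCmd <| .seq homeCmd <|
  .seq (fixCmd (.mul nE rhoE) relaxGuard (elemBlkE relaxElemE) relaxElemE 10 5 6) (incrCmd 4)

/-- The sources are reached. -/
def searchInit : Cmd :=
  .seq (.iwrite nE .tt 8 (.add (.mul .pid nE) .pid) (.const 1))
    (.iwrite nE .tt 10 (.mul .pid rhoE) (.add (.add (.mul .pid nE) .pid) (.const 1)))

/-- The searches from all vertices. -/
def searchLoop : Cmd := .loop (.ilt (.read 0 (.const 4)) rhoE) searchRound

/-- The block of an element. -/
def elemBlk (n ρ : ℕ) (home : ℕ → ℕ) (E : ℕ) : ℕ := E / n * ρ + (home E - 1)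

/-- The memory before the searches. -/
structure SearchInput (n ρ : ℕ) (head : ℕ → ℕ) (w : ℕ → ℝ) (list : ℕ → ℕ) (s : Memory) :
    Prop where
  n_eq : s.int 0 0 = n
  ρ_eq : s.int 0 2 = ρ
  ρ_pos : 0 < ρ
  ρ_le : ρ ≤ n
  count : s.int 0 4 = 0
  head_eq : s.int 3 = head
  list_eq : s.int 5 = list
  w_eq : s.real 0 = w
  zero : ∀ a, 8 ≤ a → s.int a = 0
  rzero : s.real 5 = 0

/-- The memory after `i` rounds of the searches. -/
structure SearchMem (n ρ : ℕ) (head : ℕ → ℕ) (w : ℕ → ℝ) (list : ℕ → ℕ) (δ : ℕ → ℕ → ℝ)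
    (s₁ : Memory) (i : ℕ) (s : Memory) : Prop where
  agree : AgreeOff [0, 8, 9, 10, 11] [1, 5, 6] s₁ s
  count : s.int 0 4 = i
  other : ∀ j, j ≠ 4 → s.int 0 j = s₁.int 0 j
  bm : BlockMin (Live n (s.int 8) (s.int 9)) (s.real 5) (elemBlk n ρ (s.int 8)) (s.int 10)
  inv : SearchInv n ρ head w list δ i (s.int 8) (s.int 9) (s.real 5) (s.int 11) (s.real 1)

section

variable {n M ρ B N : ℕ} {tail head : ℕ → ℕ} {w : ℕ → ℝ} {list : ℕ → ℕ} {δ : ℕ → ℕ → ℝ}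
  {s₁ : Memory}

/-- Only the sources need to be entered: the zeros of the initial memory serve as tentative distance
of the sources, as unset `home`, and as empty blocks. -/
theorem searchInit_runs (hself : ∀ v < n, δ v v = 0) (h : SearchInput n ρ head w list s₁) (hB : n * n + n + 1 ≤ B)
    (hN : n ≤ N) : ∃ t, Runs B N searchInit s₁ t ∧ SearchMem n ρ head w list δ s₁ 0 t := by
  have hz : ∀ a, 8 ≤ a → ∀ c, s₁.int a c = 0 := fun a ha c => by rw [h.zero a ha]; rfl
  obtain ⟨f, run₁, w₁⟩ := runs_iwrite (B := B) (N := N) s₁ nE .tt 8 (.add (.mul .pid nE) .pid)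
    (.const 1) (k := n) (act := fun _ => True) (addr := fun q => q * n + q) (val := fun _ => 1)
    h.n_eq (by omega) hN (fun _ _ => Iff.rfl) (fun q _ _ => by simp only [IExpr.eval, h.n_eq])
    (fun _ _ _ => rfl) (fun q hq _ => ⟨by have := (sq_index hq hq).1; omega, by omega⟩)
  obtain ⟨g, run₂, w₂⟩ := runs_iwrite (B := B) (N := N) (s₁.setI 8 f) nE .tt 10 (.mul .pid rhoE)
    (.add (.add (.mul .pid nE) .pid) (.const 1)) (k := n) (act := fun _ => True)
    (addr := fun q => q * ρ) (val := fun q => q * n + q + 1)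
    h.n_eq (by omega) hN (fun _ _ => Iff.rfl)
    (fun q _ _ => by simp [IExpr.eval, h.ρ_eq])
    (fun q _ _ => by simp [IExpr.eval, h.n_eq]) (fun q hq _ => by
      have := (sq_index hq hq).1
      have := Nat.mul_le_mul hq.le h.ρ_le
      constructor <;> omega)
  have hf : ∀ v < n, f (v * n + v) = 1 := by
    intro v hv
    rcases w₁ (v * n + v) with ⟨q, -, -, -, hval, -⟩ | ⟨hno, -⟩
    · exact hval
    · exact absurd rfl (hno v hv trivial)
  have hf' : ∀ E, f E ≠ 0 → f E = 1 ∧ ∃ v < n, E = v * n + v := by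
    intro E hE
    rcases w₁ E with ⟨q, hq, -, ha, hval, -⟩ | ⟨-, ho⟩
    · exact ⟨hval, q, hq, ha.symm⟩
    · rw [hz 8 (by omega)] at ho
      exact absurd ho hE
  have hg : ∀ v < n, g (v * ρ) = v * n + v + 1 := by
    intro v hv
    rcases w₂ (v * ρ) with ⟨q, hq, -, ha, hval, -⟩ | ⟨hno, -⟩
    · obtain rfl := Nat.eq_of_mul_eq_mul_right h.ρ_pos ha
      exact hval
    · exact absurd rfl (hno v hv trivial)
  have hg' : ∀ c, g c ≠ 0 → ∃ v < n, c = v * ρ := by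
    intro c hc
    rcases w₂ c with ⟨q, hq, -, ha, -⟩ | ⟨-, ho⟩
    · exact ⟨q, hq, ha.symm⟩
    · rw [Memory.setI_int_of_ne _ _ (by decide), hz 10 (by omega)] at ho
      exact absurd ho hc
  have hblk : ∀ v < n, elemBlk n ρ f (v * n + v) = v * ρ := fun v hv => by
    rw [elemBlk, (sq_index hv hv).2.1, hf v hv]
    rfl
  refine ⟨_, run₁.seq run₂, ((AgreeOff.refl _ _ _).setI (by simp) _).setI (by simp) _, ?_, ?_, ?_,
    ?_⟩
  · simpa using h.count
  · intro j _; simp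
  · simp only [Memory.setI_int_self, Memory.setI_int_of_ne _ g (show 8 ≠ 10 by decide),
      Memory.setI_int_of_ne _ g (show 9 ≠ 10 by decide),
      Memory.setI_int_of_ne _ f (show 9 ≠ 8 by decide), Memory.setI_real]
    constructor
    · intro c e hc
      obtain ⟨v, hv, rfl⟩ := hg' c (by omega)
      rw [hg v hv] at hc
      obtain rfl : v * n + v = e := by omega
      exact ⟨⟨(sq_index hv hv).1, by rw [hf v hv]; omega, hz 9 (by omega) _⟩, hblk v hv⟩
    · rintro e ⟨h1, h2, h3⟩
      obtain ⟨-, v, hv, rfl⟩ := hf' e h2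
      exact ⟨_, by rw [hblk v hv, hg v hv], le_rfl⟩
  · simp only [Memory.setI_int_self, Memory.setI_int_of_ne _ g (show 8 ≠ 10 by decide),
      Memory.setI_int_of_ne _ g (show 9 ≠ 10 by decide),
      Memory.setI_int_of_ne _ g (show 11 ≠ 10 by decide),
      Memory.setI_int_of_ne _ f (show 11 ≠ 8 by decide),
      Memory.setI_int_of_ne _ f (show 9 ≠ 8 by decide), Memory.setI_real]
    refine ⟨fun v _ j _ _ => hz 11 (by omega) _, ?_, fun v _ j hj => by omega, ?_,
      fun v _ j hj => by omega, fun v _ j hj => by omega, ?_, ?_⟩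
    · intro v hv z hz b hb _
      obtain ⟨h1, u, hu, h2⟩ := hf' _ (by rw [hb]; omega)
      obtain ⟨h3, h4⟩ := mul_add_inj hz hu h2
      exact Or.inr ⟨rfl, by omega, by omega⟩
    · intro v _ z _ hne
      exact absurd (hz 9 (by omega) _) hne
    · rintro v hv z hz' ⟨-, h2, -⟩
      obtain ⟨-, u, hu, h3⟩ := hf' _ h2
      obtain ⟨rfl, rfl⟩ := mul_add_inj hz' hu h3
      rw [hself _ hv, h.rzero]
      rfl
    · intro v hv
      exact Or.inl ⟨rfl, by rw [hf v hv]; omega, by rw [h.rzero]; rfl⟩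

/-- The arc, plus `1`, from the list of the vertex that has created the block of the selected
element. -/
def popArc (n ρ : ℕ) (list home sel : ℕ → ℕ) (i q : ℕ) : ℕ :=
  list ((sel (q / ρ * ρ + (home (sel (q / ρ * ρ + i) - 1) - 1)) - 1) % n * ρ + q % ρ)

/-- The element of the head of that arc. -/
def popElem (n ρ : ℕ) (head list home sel : ℕ → ℕ) (i q : ℕ) : ℕ :=
  q / ρ * n + head (popArc n ρ list home sel i q - 1)

/-- A round of first reach is below `i ≤ ρ`, or it is the `0` of the source; so `ρ` block numbers
per search suffice. -/
theorem SearchInv.blk_lt {home dead : ℕ → ℕ} {tent : ℕ → ℝ} {sel : ℕ → ℕ} {D : ℕ → ℝ} {i : ℕ}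
    (h : SearchInv n ρ head w list δ i home dead tent sel D) (hi : i ≤ ρ) (hρ : 0 < ρ) {E : ℕ}
    (hE : Live n home dead E) : home E - 1 < ρ := by
  obtain ⟨h1, h2, h3⟩ := elem_split hE.1
  obtain ⟨-, h4, h5⟩ := hE
  rw [← h3] at h4 h5 ⊢
  rcases h.home_eq _ h1 _ h2 (home (E / n * n + E % n) - 1) (by omega) h5 with ⟨h6, -⟩ | ⟨-, h6, -⟩
    <;> omega

/-- The block of a selected element is rescanned through `home`: it gives the round of first reach,
the slot of that round gives the vertex settled then, and every live element of the block is the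
head of an arc in the list of this vertex. -/
theorem searchPop_runs (hN : Net n M ρ tail head w list δ) (h : SearchInput n ρ head w list s₁)
    {i : ℕ} (hi : i < ρ) (hB : n * n + n + ρ + 3 ≤ B) (hNN : n + n * ρ ≤ N) {s : Memory}
    (hs : SearchMem n ρ head w list δ s₁ i s) :
    ∃ t, Runs B N (popCmd (.mul nE rhoE) (.read 0 (.const 4)) 11 10 9 5 1 6
        (fun x => .div x nE) elemBlkE popGuard popElemE) s t ∧
      AgreeOff [11, 10, 9] [1, 6] s t ∧
      PopSpec n ρ i (Live n (s.int 8) (s.int 9)) (s.real 5) (fun E => E / n) (s.int 11)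
        (s.real 1) (s.int 9) (t.int 11) (t.real 1) (t.int 9) ∧
      BlockMin (fun e => Live n (s.int 8) (s.int 9) e ∧ ¬ Popped n ρ i (t.int 11) e) (s.real 5)
        (elemBlk n ρ (s.int 8)) (t.int 10) := by
  have hρ := h.ρ_pos
  have hnρ := Nat.mul_le_mul_left n h.ρ_le
  have h02 : s.int 0 2 = ρ := by rw [hs.other 2 (by decide), h.ρ_eq]
  have h00 : s.int 0 0 = n := by rw [hs.other 0 (by decide), h.n_eq]
  have i3 : s.int 3 = head := (hs.agree.1 3 (by decide)).trans h.head_eq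
  have i5 : s.int 5 = list := (hs.agree.1 5 (by decide)).trans h.list_eq
  have key : ∀ t, AgreeOff [11, 10, 9] [1, 6] s t → t.int 0 = s.int 0 ∧ t.int 3 = head ∧
      t.int 5 = list ∧ t.int 8 = s.int 8 :=
    fun t ht => ⟨ht.1 0 (by decide), (ht.1 3 (by decide)).trans i3,
      (ht.1 5 (by decide)).trans i5, ht.1 8 (by decide)⟩
  have hlt := fun E hE => hs.inv.blk_lt (E := E) hi.le hρ hE
  refine runs_popCmd (B := B) (N := N) s
    (n := n) (ρ := ρ) (r := i) (k := n * ρ)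
    (el := fun sel q => popElem n ρ head list (s.int 8) sel i q)
    (G := fun sel dead q => 0 < sel (q / ρ * ρ + i) ∧ 0 < popArc n ρ list (s.int 8) sel i q ∧
      dead (popElem n ρ head list (s.int 8) sel i q) < 1 ∧
      ¬ s.int 8 (popElem n ρ head list (s.int 8) sel i q) < s.int 8 (sel (q / ρ * ρ + i) - 1) ∧
      ¬ s.int 8 (sel (q / ρ * ρ + i) - 1) < s.int 8 (popElem n ρ head list (s.int 8) sel i q))
    (γ := fun e => e / n)
    (by decide) (by decide) h00 h02 hi (by omega) (by omega) (by omega) (by omega) (by omega)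
    (by omega)
    (fun t ht => by simp only [IExpr.eval, (key t ht).1, h00, h02])
    (fun t ht q => by simp only [IExpr.eval, (key t ht).1, hs.count])
    (fun t ht x q _ => by simp only [IExpr.eval, (key t ht).1, h00])
    (fun t ht x q _ => by
      obtain ⟨k0, -, -, k8⟩ := key t ht
      simp only [elemBlkE, elemBlk, IExpr.eval, k0, k8, h00, h02])
    (fun t ht q => by
      obtain ⟨k0, k3, k5, k8⟩ := key t ht
      simp only [popElemE, popArcE, curE, procE, popElem, popArc, IExpr.eval, k0, k3, k5, k8, h00,
        h02, hs.count])
    (fun t ht q => by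
      obtain ⟨k0, k3, k5, k8⟩ := key t ht
      simp only [popGuard, popElemE, popArcE, curE, procE, popElem, popArc, IExpr.eval, BExpr.eval,
        k0, k3, k5, k8, h00, h02, hs.count])
    hs.bm
    (fun e he => (elem_split he.1).1)
    (fun e he => (sq_index (elem_split he.1).1 (hlt e he)).1)
    (fun e e' he he' heq => (mul_add_inj (hlt e he) (hlt e' he') heq).1)
    (fun e he => by have := he.1; omega)
    (fun g hg => hs.inv.fresh g hg i le_rfl hi) ?_
  intro sel' selw' dead' hp
  constructor
  · rintro q hq ⟨g1, g2, g3, g4, g5⟩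
    have hqn : q / ρ < n := Nat.div_lt_of_lt_mul (by rwa [mul_comm] at hq)
    obtain ⟨E, hE⟩ : ∃ E, sel' (q / ρ * ρ + i) = E + 1 := ⟨_, (Nat.sub_add_cancel g1).symm⟩
    obtain ⟨hlive, hgr, -⟩ := hp.alive_of_popped hqn hE
    obtain ⟨-, hz, hspl⟩ := elem_split hlive.1
    rw [hgr] at hspl
    rw [hE, Nat.add_sub_cancel] at g4 g5
    set E' := popElem n ρ head list (s.int 8) sel' i q with hE'
    have hx : (sel' (q / ρ * ρ + (s.int 8 E - 1)) - 1) % n < n := Nat.mod_lt _ (by omega)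
    have harc : list ((sel' (q / ρ * ρ + (s.int 8 E - 1)) - 1) % n * ρ + q % ρ) =
        popArc n ρ list (s.int 8) sel' i q - 1 + 1 := by
      rw [Nat.sub_add_cancel g2, popArc, hE, Nat.add_sub_cancel]
    have hh := hN.head_lt _ (hN.light.arc _ hx _ (Nat.mod_lt q hρ) _ harc).1
    obtain ⟨q1, q2, -⟩ := sq_index hqn hh
    have hnp : ¬ Popped n ρ i sel' E' := fun hpp => by
      rw [hp.dead_of_popped E' hpp] at g3; omega
    have hne := hlive.2.1
    refine ⟨⟨⟨q1, by omega, ?_⟩, hnp⟩, E, ⟨_, hqn, hE⟩, ?_⟩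
    · rw [← hp.dead_of_not E' hnp]; omega
    · unfold elemBlk
      rw [hgr, show s.int 8 E' = s.int 8 E by omega, hE', popElem, q2]
  · rintro E₁ hlive₁ hnp E ⟨v, hv, hE⟩ hblk
    obtain ⟨hlive, hgr, -⟩ := hp.alive_of_popped hv hE
    obtain ⟨-, hz, hspl⟩ := elem_split hlive.1
    obtain ⟨-, hz₁, hspl₁⟩ := elem_split hlive₁.1
    obtain ⟨hg, hh⟩ := mul_add_inj (hlt _ hlive₁) (hlt _ hlive) hblk
    have hne := hlive.2.1
    have hne₁ := hlive₁.2.1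
    rw [hgr] at hspl
    rw [hg, hgr] at hspl₁
    have hhome : s.int 8 E₁ = s.int 8 E := by omega
    have hcase : ∀ z < n, Live n (s.int 8) (s.int 9) (v * n + z) →
        s.int 8 (v * n + z) = s.int 8 E → (i = 0 ∧ z = v) ∨ (s.int 8 E - 1 < i ∧ ∃ x < n,
          s.int 11 (v * ρ + (s.int 8 E - 1)) = v * n + x + 1 ∧
            ∃ e, InList ρ list x e ∧ head e = z) := by
      intro z hz hl heq
      rcases hs.inv.home_eq v hv z hz (s.int 8 E - 1) (by omega) hl.2.2 with h1 | ⟨h1, -, h2⟩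
      · exact Or.inr h1
      · exact Or.inl ⟨h1, h2⟩
    -- Before round `0` is over, a block contains only the source, so nothing but the selected
    -- element is in it. Otherwise the slot of the creating round is earlier than `i` and was not
    -- changed by the selection.
    rcases hcase (E₁ % n) hz₁ (hspl₁.symm ▸ hlive₁) (by rw [hspl₁, hhome]) with
      ⟨h1, h2⟩ | ⟨h1, x, hx, h2, e, ⟨j, hj, hl⟩, he⟩
    · rcases hcase (E % n) hz (hspl.symm ▸ hlive) (by rw [hspl]) with ⟨-, h3⟩ | ⟨h3, -⟩
      · exact absurd ⟨v, hv, by rw [hE, ← hspl, ← hspl₁, h2, h3]⟩ hnp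
      · omega
    · obtain ⟨q1, q2, q3⟩ := sq_index hv hj
      have h2' : sel' (v * ρ + (s.int 8 E - 1)) = v * n + x + 1 := by
        rw [(hp.other _ fun g _ heq => absurd (mul_add_inj (by omega) hi heq).2 (by omega)).1, h2]
      have harc : popArc n ρ list (s.int 8) sel' i (v * ρ + j) = e + 1 := by
        rw [popArc, q2, q3, hE, Nat.add_sub_cancel, h2', Nat.add_sub_cancel,
          (sq_index hv hx).2.2, hl]
      have hel : popElem n ρ head list (s.int 8) sel' i (v * ρ + j) = E₁ := by
        rw [popElem, harc, q2, Nat.add_sub_cancel, he, hspl₁]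
      refine ⟨v * ρ + j, q1, ?_, hel⟩
      rw [hel, harc, q2, hE, Nat.add_sub_cancel, hhome]
      refine ⟨by omega, by omega, ?_, by omega, by omega⟩
      rw [hp.dead_of_not E₁ hnp, hlive₁.2.2]
      omega

/-- After the selection, relaxation inserts elements and lowers keys. An element never moves to
another block, so minima are repaired by offering the relaxed heads that beat the current entry of
their block. -/
theorem searchRound_runs (hN : Net n M ρ tail head w list δ)
    (h : SearchInput n ρ head w list s₁) {i : ℕ} (hi : i < ρ) (hB : n * n + n + ρ + 5 ≤ B)
    (hNN : n + n * ρ ≤ N) {s : Memory} (hs : SearchMem n ρ head w list δ s₁ i s) :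
    ∃ t, Runs B N searchRound s t ∧ SearchMem n ρ head w list δ s₁ (i + 1) t := by
  have hρ := h.ρ_pos
  have hρn := h.ρ_le
  have hnρ := Nat.mul_le_mul_left n h.ρ_le
  have h02 : s.int 0 2 = ρ := by rw [hs.other 2 (by decide), h.ρ_eq]
  have h00 : s.int 0 0 = n := by rw [hs.other 0 (by decide), h.n_eq]
  obtain ⟨t, run₁, ag₁, hp, hbm₁⟩ := searchPop_runs (B := B) hN h hi (by omega) hNN hs
  have hpop := fun v hv => hs.inv.pop hN hi hρn hp (v := v) hv
  choose! y hy using hpop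
  have k0 : t.int 0 = s.int 0 := ag₁.1 0 (by decide)
  have k3 : t.int 3 = head := (ag₁.1 3 (by decide)).trans
    ((hs.agree.1 3 (by decide)).trans h.head_eq)
  have k5 : t.int 5 = list := (ag₁.1 5 (by decide)).trans
    ((hs.agree.1 5 (by decide)).trans h.list_eq)
  have k8 : t.int 8 = s.int 8 := ag₁.1 8 (by decide)
  have kr0 : t.real 0 = w := (ag₁.2 0 (by decide)).trans
    ((hs.agree.2 0 (by decide)).trans h.w_eq)
  have kr5 : t.real 5 = s.real 5 := ag₁.2 5 (by decide)
  have hel : ∀ q < n * ρ, 0 < relaxArc n ρ list (t.int 11) i q → q / ρ < n ∧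
      InList ρ list (y (q / ρ)) (relaxArc n ρ list (t.int 11) i q - 1) ∧
      head (relaxArc n ρ list (t.int 11) i q - 1) < n := by
    intro q hq ha
    have hqv : q / ρ < n := Nat.div_lt_of_lt_mul (by rwa [mul_comm] at hq)
    obtain ⟨g1, -, g2, -⟩ := hy _ hqv
    have hl : list (y (q / ρ) * ρ + q % ρ) = relaxArc n ρ list (t.int 11) i q - 1 + 1 := by
      rw [Nat.sub_add_cancel ha, relaxArc, g2, Nat.add_sub_cancel, (sq_index hqv g1).2.2]
    exact ⟨hqv, ⟨_, Nat.mod_lt q hρ, hl⟩,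
      hN.head_lt _ (hN.light.arc _ g1 _ (Nat.mod_lt q hρ) _ hl).1⟩
  have helB : ∀ q < n * ρ, 0 < relaxArc n ρ list (t.int 11) i q →
      relaxElem n ρ head list (t.int 11) i q < n * n := fun q hq ha =>
    (sq_index (hel q hq ha).1 (hel q hq ha).2.2).1
  have ev : ∀ t' : Memory, t'.int 0 = t.int 0 → t'.int 11 = t.int 11 → t'.int 3 = t.int 3 →
      t'.int 5 = t.int 5 → ∀ q, relaxArcE.eval t' q = relaxArc n ρ list (t.int 11) i q ∧
        relaxElemE.eval t' q = relaxElem n ρ head list (t.int 11) i q := by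
    intro t' e0 e11 e3 e5 q
    constructor <;>
    simp only [relaxElemE, relaxArcE, curE, procE, relaxElem, relaxArc, IExpr.eval, e0, e11, e3,
      e5, k0, k3, k5, h00, h02, hs.count]
  obtain ⟨f, run₂, w₂⟩ := runs_rwrite (B := B) (N := N) t (.mul nE rhoE)
    (.and (.ilt (.const 0) relaxArcE) <| .and (.ilt (.read 9 relaxElemE) (.const 1)) <|
      .not (.and (.not (.ilt (.read 8 relaxElemE) (.const 1)))
        (.not (.rlt relaxLenE (.read 5 relaxElemE))))) 5 relaxElemE relaxLenE (k := n * ρ)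
    (act := RelaxAct n ρ head w list i (s.int 8) (s.real 5) (t.int 11) (t.real 1) (t.int 9))
    (addr := relaxElem n ρ head list (t.int 11) i)
    (val := fun q => t.real 1 (q / ρ * ρ + i) + w (relaxArc n ρ list (t.int 11) i q - 1))
    (by simp only [IExpr.eval, k0, h00, h02]) (by omega) (by omega)
    (fun q _ => by
      obtain ⟨e1, e2⟩ := ev t rfl rfl rfl rfl q
      simp only [BExpr.eval, RExpr.eval, IExpr.eval, e1, e2, RelaxAct, relaxLenE, procE, k0, k8,
        kr0, kr5, h02, hs.count])
    (fun q _ _ => (ev t rfl rfl rfl rfl q).2)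
    (fun q _ _ => by
      obtain ⟨e1, e2⟩ := ev t rfl rfl rfl rfl q
      simp only [RExpr.eval, IExpr.eval, e1, relaxLenE, procE, k0, kr0, h02, hs.count])
    (fun q hq ha => by have := helB q hq ha.1; omega)
  obtain ⟨g, run₃, w₃⟩ := runs_iwrite (B := B) (N := N) (t.setR 5 f) (.mul nE rhoE)
    (.and (.ilt (.const 0) relaxArcE) <| .and (.ilt (.read 9 relaxElemE) (.const 1)) <|
      .ilt (.read 8 relaxElemE) (.const 1)) 8 relaxElemE
    (.add (.read 0 (.const 4)) (.const 1)) (k := n * ρ)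
    (act := ReachAct n ρ head list i (s.int 8) (t.int 11) (t.int 9))
    (addr := relaxElem n ρ head list (t.int 11) i) (val := fun _ => i + 1)
    (by simp only [IExpr.eval, Memory.setR_int, k0, h00, h02]) (by omega) (by omega)
    (fun q _ => by
      obtain ⟨e1, e2⟩ := ev (t.setR 5 f) rfl rfl rfl rfl q
      simp only [BExpr.eval, IExpr.eval, e1, e2, ReachAct, Memory.setR_int, k8])
    (fun q _ _ => (ev (t.setR 5 f) rfl rfl rfl rfl q).2)
    (fun q _ _ => by simp only [IExpr.eval, Memory.setR_int, k0, hs.count])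
    (fun q hq ha => by
      have := helB q hq ha.1
      constructor <;> omega)
  rw [kr5] at w₂
  rw [Memory.setR_int, k8] at w₃
  have hrel := fun v hv z hz => relaxed_of_wr hN
    (fun v hv => ⟨(hy v hv).1, (hy v hv).2.2.1, (hy v hv).2.2.2.1⟩) w₂ w₃ (v := v) (z := z) hv hz
  have hinv := hs.inv.step hN hi hp hy hrel
  set t₂ := (t.setR 5 f).setI 8 g with ht₂
  have e0 : t₂.int 0 = t.int 0 := by simp [ht₂]
  have e8 : t₂.int 8 = g := by simp [ht₂]
  have e9 : t₂.int 9 = t.int 9 := by simp [ht₂]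
  have e10 : t₂.int 10 = t.int 10 := by simp [ht₂]
  have e11 : t₂.int 11 = t.int 11 := by simp [ht₂]
  have er5 : t₂.real 5 = f := by simp [ht₂]
  have hlive : ∀ e, Live n (s.int 8) (s.int 9) e ∧ ¬ Popped n ρ i (t.int 11) e ↔
      Live n (s.int 8) (t.int 9) e := by
    intro e
    constructor
    · rintro ⟨⟨h1, h2, h3⟩, hnp⟩
      exact ⟨h1, h2, by rw [hp.dead_of_not e hnp, h3]⟩
    · rintro ⟨h1, h2, h3⟩
      have hnp : ¬ Popped n ρ i (t.int 11) e := fun hpp => by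
        rw [hp.dead_of_popped e hpp] at h3; omega
      exact ⟨⟨h1, h2, by rw [← hp.dead_of_not e hnp, h3]⟩, hnp⟩
  have hupd : ∀ e, Live n (s.int 8) (t.int 9) e → Live n g (t.int 9) e ∧
      elemBlk n ρ g e = elemBlk n ρ (s.int 8) e ∧ f e ≤ s.real 5 e := by
    rintro e ⟨h1, h2, h3⟩
    obtain ⟨g1, g2, g3⟩ := elem_split h1
    have hr := hrel _ g1 _ g2
    rw [← g3] at h2
    have h4 := hr.home_of h2
    have h5 := hr.tent_le h2
    rw [g3] at h2 h4 h5
    exact ⟨⟨h1, by rwa [h4], h3⟩, by simp only [elemBlk, h4], h5⟩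
  have hblkB : ∀ e, Live n g (t.int 9) e → elemBlk n ρ g e ≤ B := fun e he => by
    have := (sq_index (elem_split he.1).1 (hinv.blk_lt (by omega) hρ he)).1
    unfold elemBlk
    omega
  have hreached : ∀ q < n * ρ, 0 < relaxArc n ρ list (t.int 11) i q →
      t.int 9 (relaxElem n ρ head list (t.int 11) i q) < 1 →
      Live n g (t.int 9) (relaxElem n ρ head list (t.int 11) i q) := by
    intro q hq ha hd
    obtain ⟨g1, g2, g3⟩ := hel q hq ha
    exact ⟨helB q hq ha, ((hrel _ g1 _ g3).relaxed _ g2 rfl (Nat.lt_one_iff.1 hd)).1,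
      Nat.lt_one_iff.1 hd⟩
  obtain ⟨f', g', run₄, hbm₂⟩ := runs_fixCmd (B := B) (N := N) t₂ (np := .mul nE rhoE)
    (guard := relaxGuard) (cell := elemBlkE relaxElemE) (elem := relaxElemE) (barg := 10)
    (key := 5) (scr := 6) (k := n * ρ)
    (act := fun q => 0 < relaxArc n ρ list (t.int 11) i q ∧
      t.int 9 (relaxElem n ρ head list (t.int 11) i q) < 1 ∧
      ¬ (¬ t.int 10 (elemBlk n ρ g (relaxElem n ρ head list (t.int 11) i q)) < 1 ∧
        ¬ f (relaxElem n ρ head list (t.int 11) i q) <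
          f (t.int 10 (elemBlk n ρ g (relaxElem n ρ head list (t.int 11) i q)) - 1)))
    (el := relaxElem n ρ head list (t.int 11) i) (blk := elemBlk n ρ g)
    (alive := Live n g (t.int 9)) (by decide) (by omega) (by omega)
    (fun f' => by simp only [IExpr.eval, Memory.setR_int, e0, k0, h00, h02])
    (fun f' q _ => by
      obtain ⟨u1, u2⟩ := ev (t₂.setR 6 f') rfl rfl rfl rfl q
      simp only [relaxGuard, elemBlkE, BExpr.eval, RExpr.eval, IExpr.eval, u1, u2,
        Memory.setR_int, Memory.setR_real_of_ne t₂ f' (show 5 ≠ 6 by decide), e0, e8, e9, e10, er5,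
        k0, h00, h02, elemBlk])
    (fun f' q _ _ => by
      obtain ⟨u1, u2⟩ := ev (t₂.setR 6 f') rfl rfl rfl rfl q
      simp only [elemBlkE, IExpr.eval, u2, Memory.setR_int, e0, e8, k0, h00, h02, elemBlk])
    (fun f' q _ _ => (ev (t₂.setR 6 f') rfl rfl rfl rfl q).2)
    (fun e he => ⟨hblkB e he, by have := he.1; omega⟩)
    (fun c e he => by
      rw [e10] at he
      obtain ⟨h1, h2⟩ := hbm₁.sound c e he
      obtain ⟨h3, h4, -⟩ := hupd e ((hlive e).1 h1)
      exact ⟨h3, h4.trans h2⟩)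
    (fun q hq ⟨ha, hd, hlt⟩ => ⟨hreached q hq ha hd, fun e he => by
      rw [e10] at he
      rw [he, Nat.add_sub_cancel] at hlt
      rw [er5]
      by_contra hc
      exact hlt ⟨by omega, hc⟩⟩)
    (fun e he => by
      obtain ⟨hv, hz, hspl⟩ := elem_split he.1
      rw [e10, er5]
      by_cases hin : ∃ a, InList ρ list (y (e / n)) a ∧ head a = e % n
      · obtain ⟨a, ⟨j, hj, hl⟩, ha⟩ := hin
        obtain ⟨q1, q2, q3⟩ := sq_index hv hj
        obtain ⟨y1, -, y3, -⟩ := hy _ hv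
        have harc : relaxArc n ρ list (t.int 11) i (e / n * ρ + j) = a + 1 := by
          rw [relaxArc, q2, q3, y3, Nat.add_sub_cancel, (sq_index hv y1).2.2, hl]
        have hre : relaxElem n ρ head list (t.int 11) i (e / n * ρ + j) = e := by
          rw [relaxElem, harc, q2, Nat.add_sub_cancel, ha, hspl]
        by_cases hcond : ¬ t.int 10 (elemBlk n ρ g e) < 1 ∧
            ¬ f e < f (t.int 10 (elemBlk n ρ g e) - 1)
        · exact Or.inr ⟨t.int 10 (elemBlk n ρ g e) - 1, by omega, not_lt.1 hcond.2⟩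
        · refine Or.inl ⟨_, q1, ?_, hre⟩
          rw [hre, harc]
          exact ⟨by omega, by rw [he.2.2]; omega, hcond⟩
      · right
        obtain ⟨u1, u2⟩ := (hrel _ hv _ hz).untouched fun a h1 h2 => hin ⟨a, h1, h2⟩
        rw [hspl] at u1 u2
        have hl : Live n (s.int 8) (t.int 9) e := ⟨he.1, by rw [← u1]; exact he.2.1, he.2.2⟩
        obtain ⟨e', h1, h2⟩ := hbm₁.min e ((hlive e).2 hl)
        obtain ⟨-, -, h3⟩ := hupd e' ((hlive e').1 (hbm₁.sound _ _ h1).1)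
        exact ⟨e', by rw [(hupd e hl).2.1, h1], by rw [u2]; exact h3.trans h2⟩)
  set t₃ := (t₂.setR 6 f').setI 10 g' with ht₃
  have v0 : t₃.int 0 = s.int 0 := by simp [ht₃, e0, k0]
  obtain ⟨c, run₅, hc, hc'⟩ := runs_incrCmd (B := B) (N := N) t₃ 4 (by omega)
    (by have := Nat.mul_pos (show 0 < n by omega) hρ; omega) (by omega)
    (by rw [v0, hs.count]; omega)
  rw [v0] at hc hc'
  refine ⟨_, run₁.seq (Runs.seq (c := tentCmd) run₂ (Runs.seq (c := homeCmd) run₃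
    (run₄.seq run₅))), ⟨fun a ha => ?_, fun a ha => ?_⟩, ?_, ?_, ?_, ?_⟩
  · simp only [List.mem_cons, List.not_mem_nil, or_false, not_or] at ha
    obtain ⟨a0, a8, a9, a10, a11⟩ := ha
    rw [Memory.setI_int_of_ne _ _ a0, ht₃, Memory.setI_int_of_ne _ _ a10, Memory.setR_int, ht₂,
      Memory.setI_int_of_ne _ _ a8, Memory.setR_int, ag₁.1 a (by simp [a9, a10, a11]),
      hs.agree.1 a (by simp [a0, a8, a9, a10, a11])]
  · simp only [List.mem_cons, List.not_mem_nil, or_false, not_or] at ha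
    obtain ⟨a1, a5, a6⟩ := ha
    rw [Memory.setI_real, ht₃, Memory.setI_real, Memory.setR_real_of_ne _ _ a6, ht₂,
      Memory.setI_real, Memory.setR_real_of_ne _ _ a5, ag₁.2 a (by simp [a1, a6]),
      hs.agree.2 a (by simp [a1, a5, a6])]
  · rw [Memory.setI_int_self, hc, hs.count]
  · intro j hj
    rw [Memory.setI_int_self, hc' j hj, hs.other j hj]
  · simpa [ht₃, e8, e9, er5] using hbm₂
  · simpa [ht₃, ht₂] using hinv

end

end PRAM

namespace WGraph

/-! ### Distances, shortcuts and balls -/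

variable {n : ℕ} {G : WGraph n}

theorem dist_le_walkWeight {u v : Fin n} (p : G.graph.Walk u v) : G.dist u v ≤ G.walkWeight p :=
  ciInf_le ⟨0, by rintro _ ⟨q, rfl⟩; exact G.walkWeight_nonneg q⟩ p

theorem le_dist (hG : G.graph.Connected) {u v : Fin n} {c : ℝ}
    (h : ∀ p : G.graph.Walk u v, c ≤ G.walkWeight p) : c ≤ G.dist u v := by
  have : Nonempty (G.graph.Walk u v) := hG.preconnected u v
  exact le_ciInf h

@[simp] theorem walkWeight_nil (u : Fin n) :
    G.walkWeight (SimpleGraph.Walk.nil : G.graph.Walk u u) = 0 := by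
  simp [walkWeight]

@[simp] theorem walkWeight_cons {u v x : Fin n} (h : G.graph.Adj u v) (p : G.graph.Walk v x) :
    G.walkWeight (p.cons h) = G.weight s(u, v) + G.walkWeight p := by
  simp [walkWeight]

theorem walkWeight_append {u v x : Fin n} (p : G.graph.Walk u v) (q : G.graph.Walk v x) :
    G.walkWeight (p.append q) = G.walkWeight p + G.walkWeight q := by
  simp [walkWeight, SimpleGraph.Walk.edges_append]

theorem dist_self (u : Fin n) : G.dist u u = 0 :=
  le_antisymm ((dist_le_walkWeight .nil).trans_eq (walkWeight_nil u)) (G.dist_nonneg u u)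

theorem dist_triangle (hG : G.graph.Connected) (u v x : Fin n) :
    G.dist u x ≤ G.dist u v + G.dist v x := by
  rw [← sub_le_iff_le_add]
  refine le_dist hG fun p => ?_
  rw [sub_le_iff_le_add, add_comm, ← sub_le_iff_le_add]
  refine le_dist hG fun q => ?_
  rw [sub_le_iff_le_add, add_comm, ← walkWeight_append]
  exact dist_le_walkWeight _

theorem dist_le_weight {u v : Fin n} (h : G.graph.Adj u v) : G.dist u v ≤ G.weight s(u, v) :=
  (dist_le_walkWeight (.cons h .nil)).trans_eq (by simp)

theorem exists_exit_walk (hG : G.graph.Connected) (S : Set (Fin n)) {u x : Fin n}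
    (p : G.graph.Walk u x) (hu : u ∈ S) (hx : x ∉ S) : ∃ d : G.graph.Dart,
      d.fst ∈ S ∧ d.snd ∉ S ∧ G.dist u d.fst + G.weight d.edge ≤ G.walkWeight p := by
  induction p with
  | nil => exact absurd hu hx
  | @cons a b c h p ih =>
    by_cases hb : b ∈ S
    · obtain ⟨d, h1, h2, h3⟩ := ih hb hx
      refine ⟨d, h1, h2, ?_⟩
      have h4 := dist_triangle hG a b d.fst
      have h5 := dist_le_weight h
      rw [walkWeight_cons]
      linarith
    · refine ⟨⟨(a, b), h⟩, hu, hb, ?_⟩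
      have := G.walkWeight_nonneg p
      rw [walkWeight_cons, dist_self]
      change 0 + G.weight s(a, b) ≤ _
      linarith

/-- On the way from `u ∈ S` to `x ∉ S` some arc leaves `S`. -/
theorem exists_exit (hG : G.graph.Connected) (S : Set (Fin n)) {u x : Fin n}
    (hu : u ∈ S) (hx : x ∉ S) : ∃ d : G.graph.Dart,
      d.fst ∈ S ∧ d.snd ∉ S ∧ G.dist u d.fst + G.weight d.edge ≤ G.dist u x := by
  classical
  obtain ⟨p⟩ := hG.preconnected u x
  obtain ⟨d₀, h1, h2, -⟩ := exists_exit_walk hG S p hu hx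
  obtain ⟨d, hd, hmin⟩ := Set.exists_min_image {d : G.graph.Dart | d.fst ∈ S ∧ d.snd ∉ S}
    (fun d => G.dist u d.fst + G.weight d.edge) (Set.toFinite _) ⟨d₀, h1, h2⟩
  refine ⟨d, hd.1, hd.2, le_dist hG fun q => ?_⟩
  obtain ⟨d', h1, h2, h3⟩ := exists_exit_walk hG S q hu hx
  exact (hmin d' ⟨h1, h2⟩).trans h3

theorem nearestDist_eq {ρ : ℕ} {u : Fin n} {f : Fin ρ → Fin n} (hf : Function.Injective f)
    (j₀ : Fin ρ) (h₁ : ∀ j, G.dist u (f j) ≤ G.dist u (f j₀))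
    (h₂ : ∀ x, x ∉ Set.range f → G.dist u (f j₀) ≤ G.dist u x) :
    G.nearestDist ρ u = G.dist u (f j₀) := by
  have hcard : (Set.range f).ncard = ρ := by
    rw [← Set.image_univ, Set.ncard_image_of_injective _ hf, Set.ncard_univ, Nat.card_fin]
  refine IsLeast.csInf_eq ⟨?_, fun r hr => ?_⟩
  · change ρ ≤ _
    conv_lhs => rw [← hcard]
    exact Set.ncard_le_ncard (by rintro _ ⟨j, rfl⟩; exact h₁ j) (Set.toFinite _)
  · by_contra hlt
    rw [not_le] at hlt
    have hsub : G.enclosedBall u r ⊆ Set.range f \ {f j₀} := by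
      intro x hx
      have hx' : G.dist u x ≤ r := hx
      refine ⟨?_, ?_⟩
      · by_contra hc
        have := h₂ x hc
        linarith
      · rintro rfl
        linarith
    have h3 := Set.ncard_le_ncard hsub (Set.toFinite _)
    have h4 := Set.ncard_sdiff_singleton_lt_of_mem (Set.mem_range_self (f := f) j₀)
      (Set.toFinite _)
    have h5 : ρ ≤ (G.enclosedBall u r).ncard := hr
    omega

open Classical in
theorem weight_withShortcuts (S : Fin n → Set (Fin n)) (u v : Fin n) :
    (G.withShortcuts S).weight s(u, v) =
      if (SimpleGraph.fromRel fun u v => v ∈ S u).Adj u v then G.dist u v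
      else G.weight s(u, v) := by
  simp only [withShortcuts, SimpleGraph.mem_edgeSet, Sym2.lift_mk]

theorem connected_withShortcuts (hG : G.graph.Connected) (S : Fin n → Set (Fin n)) :
    (G.withShortcuts S).graph.Connected :=
  hG.mono le_sup_left

theorem dist_withShortcuts (hG : G.graph.Connected) (S : Fin n → Set (Fin n)) (u v : Fin n) :
    (G.withShortcuts S).dist u v = G.dist u v := by
  classical
  apply le_antisymm
  · refine le_dist hG fun p => ?_
    suffices h : ∃ q : (G.withShortcuts S).graph.Walk u v,
        (G.withShortcuts S).walkWeight q ≤ G.walkWeight p by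
      obtain ⟨q, hq⟩ := h
      exact (dist_le_walkWeight q).trans hq
    induction p with
    | nil => exact ⟨.nil, by simp⟩
    | @cons a b c h p ih =>
      obtain ⟨q, hq⟩ := ih
      have h' : (G.withShortcuts S).graph.Adj a b := Or.inl h
      refine ⟨.cons h' q, ?_⟩
      rw [walkWeight_cons, walkWeight_cons, weight_withShortcuts]
      refine add_le_add ?_ hq
      split_ifs
      · exact dist_le_weight h
      · exact le_rfl
  · refine le_dist (connected_withShortcuts hG S) fun p => ?_
    induction p with
    | nil => simp [dist_self]
    | @cons a b c h p ih =>
      rw [walkWeight_cons, weight_withShortcuts]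
      refine (dist_triangle hG a b c).trans (add_le_add ?_ ih)
      split_ifs with hs
      · exact le_rfl
      · exact dist_le_weight (h.resolve_right hs)

theorem isBallGraph_withShortcuts (hG : G.graph.Connected) {ρ : ℕ} {f : Fin n → Fin ρ → Fin n}
    (hf : ∀ v, Function.Injective (f v)) (j₀ : Fin ρ)
    (h₁ : ∀ v j, G.dist v (f v j) ≤ G.dist v (f v j₀))
    (h₂ : ∀ v x, x ∉ Set.range (f v) → G.dist v (f v j₀) ≤ G.dist v x) :
    (G.withShortcuts fun v => Set.range (f v)).IsBallGraph 1 ρ := by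
  classical
  set H := G.withShortcuts fun v => Set.range (f v) with hH
  have hd : ∀ u v, H.dist u v = G.dist u v := dist_withShortcuts hG _
  intro u
  have hn : H.nearestDist ρ u = G.dist u (f u j₀) := by
    rw [nearestDist_eq (hf u) j₀ (by simpa only [hd] using h₁ u) (by simpa only [hd] using h₂ u),
      hd]
  unfold HasBall kRadius
  rw [hn]
  refine le_iInf₂ fun x hx => ?_
  rw [hd, EReal.coe_le_coe_iff]
  refine h₂ u x fun hmem => ?_
  rcases eq_or_ne u x with rfl | hne
  · have : H.hopDist u u ≤ 0 := Nat.sInf_le ⟨.nil, by rw [walkWeight_nil, dist_self], rfl⟩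
    omega
  · have hadj : (SimpleGraph.fromRel fun u v => v ∈ Set.range (f u)).Adj u x :=
      (SimpleGraph.fromRel_adj _ _ _).2 ⟨hne, Or.inl hmem⟩
    have hadj' : H.graph.Adj u x := Or.inr hadj
    have : H.hopDist u x ≤ 1 := Nat.sInf_le ⟨.cons hadj' .nil, by
      rw [walkWeight_cons, walkWeight_nil, add_zero, hd, hH, weight_withShortcuts, if_pos hadj],
      rfl⟩
    omega

end WGraph

/-! ### The program -/

namespace WGraph

variable {n : ℕ} {G : WGraph n}

theorem two_mul_numEdges_le (A : G.AdjArrays) : 2 * G.numEdges ≤ n * n := by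
  have h := Fintype.card_le_of_injective
    (fun e => ((A.arc e).fst, (A.arc e).snd)) (fun e e' he => by
      refine A.arc.injective (SimpleGraph.Dart.ext _ _ ?_)
      simpa [Prod.ext_iff] using he)
  simpa using h

/-- Distances between vertices given by their numbers. -/
noncomputable def natDist (G : WGraph n) (u v : ℕ) : ℝ :=
  if h : u < n ∧ v < n then G.dist ⟨u, h.1⟩ ⟨v, h.2⟩ else 0

theorem natDist_eq (u v : Fin n) : G.natDist u v = G.dist u v := by
  simp [natDist]

theorem natDist_nonneg (u v : ℕ) : 0 ≤ G.natDist u v := by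
  unfold natDist
  split_ifs
  · exact G.dist_nonneg _ _
  · exact le_rfl

theorem ballInput_tail (A : G.AdjArrays) (ρ : ℕ) (e : Fin (2 * G.numEdges)) :
    (ballInput G A ρ).int 2 e = (A.arc e).fst := by
  simp [ballInput]

theorem ballInput_head (A : G.AdjArrays) (ρ : ℕ) (e : Fin (2 * G.numEdges)) :
    (ballInput G A ρ).int 3 e = (A.arc e).snd := by
  simp [ballInput]

theorem ballInput_weight (A : G.AdjArrays) (ρ : ℕ) (e : Fin (2 * G.numEdges)) :
    (ballInput G A ρ).real 0 e = G.weight (A.arc e).edge := by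
  simp [ballInput]

theorem arcInput_ballInput (A : G.AdjArrays) {ρ : ℕ} (hρ : 0 < ρ) :
    PRAM.ArcInput n (2 * G.numEdges) ρ (ballInput G A ρ) where
  n_eq := by simp [ballInput]
  M_eq := by simp [ballInput]
  ρ_eq := by simp [ballInput]
  ρ_pos := hρ
  tail_lt e he := by
    rw [show e = ((⟨e, he⟩ : Fin (2 * G.numEdges)) : ℕ) from rfl, ballInput_tail]
    exact Fin.is_lt _
  head_lt e he := by
    rw [show e = ((⟨e, he⟩ : Fin (2 * G.numEdges)) : ℕ) from rfl, ballInput_head]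
    exact Fin.is_lt _
  mono e e' hle he' := by
    have h₁ := ballInput_tail A ρ ⟨e, hle.trans_lt he'⟩
    have h₂ := ballInput_tail A ρ ⟨e', he'⟩
    dsimp only at h₁ h₂
    rw [h₁, h₂]
    exact A.mono hle
  count := by simp [ballInput]
  zero a ha := by
    funext j
    simp only [ballInput]
    rw [if_neg (by omega), if_neg (by omega), if_neg (by omega), if_neg (by omega)]
    rfl
  rzero a ha := by
    funext j
    simp only [ballInput]
    rw [if_neg (by omega)]
    rfl

theorem net_ballInput (hG : G.graph.Connected) (A : G.AdjArrays) {ρ : ℕ} (hρ : 0 < ρ)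
    {list : ℕ → ℕ} (hl : PRAM.LightArcs n (2 * G.numEdges) ρ ((ballInput G A ρ).int 2)
      ((ballInput G A ρ).real 0) list) :
    PRAM.Net n (2 * G.numEdges) ρ ((ballInput G A ρ).int 2) ((ballInput G A ρ).int 3)
      ((ballInput G A ρ).real 0) list G.natDist where
  light := hl
  head_lt := (arcInput_ballInput A hρ).head_lt
  tail_lt := (arcInput_ballInput A hρ).tail_lt
  simple e he e' he' ht hh := by
    lift e to Fin (2 * G.numEdges) using he
    lift e' to Fin (2 * G.numEdges) using he'
    rw [ballInput_tail, ballInput_tail, Fin.val_inj] at ht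
    rw [ballInput_head, ballInput_head, Fin.val_inj] at hh
    rw [A.arc.injective (SimpleGraph.Dart.ext _ _ (Prod.ext ht hh))]
  nonneg := natDist_nonneg
  self v hv := by
    lift v to Fin n using hv
    rw [natDist_eq, dist_self]
  tri v hv e he := by
    lift v to Fin n using hv
    lift e to Fin (2 * G.numEdges) using he
    rw [ballInput_tail, ballInput_head, ballInput_weight, natDist_eq, natDist_eq]
    exact (dist_triangle hG _ _ _).trans
      (by gcongr; exact dist_le_weight (A.arc e).adj)
  exit v hv S hS x hx hxS := by
    lift v to Fin n using hv
    lift x to Fin n using hx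
    obtain ⟨d, h1, h2, h3⟩ := exists_exit hG {y | S y} (u := v) (x := x) hS hxS
    refine ⟨A.arc.symm d, Fin.is_lt _, ?_⟩
    rw [ballInput_tail, ballInput_head, ballInput_weight, Equiv.apply_symm_apply, natDist_eq,
      natDist_eq]
    exact ⟨h1, h2, h3⟩

end WGraph

namespace PRAM

/-- Output of the neighbours and of the radii. -/
def outCmd : Cmd :=
  .seq (.iwrite (.mul nE rhoE) .tt 4 .pid (.mod (.sub (.read 11 .pid) (.const 1)) nE))
    (.rwrite nE .tt 2 .pid (.read 1 (.add (.mul .pid rhoE) (.sub rhoE (.const 1)))))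

/-- The program that generates `(1,ρ)`-balls. -/
def ballProgram : Cmd :=
  .seq arcInit <| .seq arcLoop <| .seq searchInit <| .seq searchLoop outCmd

theorem outCmd_runs {B N n ρ : ℕ} (s : Memory) (hn : s.int 0 0 = n) (hρ : s.int 0 2 = ρ)
    (hB : n + n * ρ ≤ B) (hN : n + n * ρ ≤ N) : ∃ t, Runs B N outCmd s t ∧
      (∀ q < n * ρ, t.int 4 q = (s.int 11 q - 1) % n) ∧ t.real 1 = s.real 1 ∧
      ∀ v < n, t.real 2 v = s.real 1 (v * ρ + (ρ - 1)) := by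
  obtain ⟨f, run₁, w₁⟩ := runs_iwrite (B := B) (N := N) s (.mul nE rhoE) .tt 4 .pid
    (.mod (.sub (.read 11 .pid) (.const 1)) nE) (k := n * ρ) (act := fun _ => True)
    (addr := id) (val := fun q => (s.int 11 q - 1) % n)
    (by simp only [IExpr.eval, hn, hρ]) (by omega) (by omega) (fun _ _ => Iff.rfl)
    (fun _ _ _ => rfl) (fun q _ _ => by simp only [IExpr.eval, hn]) (fun q hq _ => by
      have : (s.int 11 q - 1) % n < n :=
        Nat.mod_lt _ (Nat.pos_of_ne_zero (by rintro rfl; simp at hq))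
      constructor
      · rw [id]; omega
      · omega)
  obtain ⟨g, run₂, w₂⟩ := runs_rwrite (B := B) (N := N) (s.setI 4 f) nE .tt 2 .pid
    (.read 1 (.add (.mul .pid rhoE) (.sub rhoE (.const 1)))) (k := n) (act := fun _ => True)
    (addr := id) (val := fun v => s.real 1 (v * ρ + (ρ - 1)))
    (by simp [IExpr.eval, hn]) (by omega) (by omega) (fun _ _ => Iff.rfl)
    (fun _ _ _ => rfl) (fun q _ _ => by simp [RExpr.eval, IExpr.eval, hρ])
    (fun q hq _ => by rw [id]; omega)
  refine ⟨_, run₁.seq run₂, fun q hq => ?_, by simp, fun v hv => ?_⟩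
  · rw [Memory.setR_int, Memory.setI_int_self]
    rcases w₁ q with ⟨q', -, -, rfl, hval, -⟩ | ⟨hno, -⟩
    · exact hval
    · exact absurd rfl (hno q hq trivial)
  · rw [Memory.setR_real_self]
    rcases w₂ v with ⟨q', -, -, rfl, hval, -⟩ | ⟨hno, -⟩
    · exact hval
    · exact absurd rfl (hno v hv trivial)

end PRAM

open PRAM in
/-- The result of the searches is a family of balls. -/
theorem generatesBalls_of_search {n ρ : ℕ} {G : WGraph n} (hG : G.graph.Connected) (hρ : 0 < ρ)
    {head : ℕ → ℕ} {w : ℕ → ℝ} {list home dead : ℕ → ℕ} {tent : ℕ → ℝ} {sel : ℕ → ℕ}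
    {D : ℕ → ℝ} (h : SearchInv n ρ head w list G.natDist ρ home dead tent sel D) {t : Memory}
    (h4 : ∀ q < n * ρ, t.int 4 q = (sel q - 1) % n) (h1 : t.real 1 = D)
    (h2 : ∀ v < n, t.real 2 v = D (v * ρ + (ρ - 1))) : GeneratesBalls G ρ t := by
  have hset : ∀ (v : Fin n) (j : Fin ρ), ∃ x : Fin n, sel (v * ρ + j) = v * n + x + 1 ∧
      D (v * ρ + j) = G.dist v x ∧
      ∀ z : Fin n, dead (v * n + z) = 0 → G.dist v x ≤ G.dist v z := by
    intro v j
    obtain ⟨x, hx, g1, g2, -, g3, -⟩ := h.settled v v.2 j j.2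
    lift x to Fin n using hx
    refine ⟨x, g1, g2.trans (WGraph.natDist_eq v x), fun z hz => ?_⟩
    rw [← WGraph.natDist_eq, ← WGraph.natDist_eq]
    exact g3 z z.2 hz
  choose f hf using hset
  have hinj : ∀ v, Function.Injective (f v) := by
    intro v j k hjk
    refine Fin.ext (h.inj v v.2 j j.2 k k.2 ?_)
    rw [(hf v j).1, (hf v k).1, hjk]
  have hout : ∀ v j x, x ∉ Set.range (f v) → G.dist v (f v j) ≤ G.dist v x := by
    intro v j x hx
    refine (hf v j).2.2 x ?_
    by_contra hd
    obtain ⟨k, hk, g⟩ := h.listed v v.2 x x.2 hd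
    refine hx ⟨⟨k, hk⟩, Fin.ext ?_⟩
    have := (hf v ⟨k, hk⟩).1
    dsimp only at this
    omega
  set j₀ : Fin ρ := ⟨ρ - 1, by omega⟩ with hj₀
  have hmax : ∀ v j, G.dist v (f v j) ≤ G.dist v (f v j₀) := by
    intro v j
    rw [← (hf v j).2.1, ← (hf v j₀).2.1]
    exact h.mono v v.2 j j.2 j₀ j₀.2 (by rw [hj₀]; dsimp only; omega)
  refine ⟨f, fun v j => ?_, hinj, hout, fun v j => ?_, fun v => ?_,
    fun u v => WGraph.dist_withShortcuts hG _ u v,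
    WGraph.isBallGraph_withShortcuts hG hinj j₀ hmax fun v => hout v j₀⟩
  · rw [h4 _ (sq_index v.2 j.2).1, (hf v j).1, Nat.add_sub_cancel, (sq_index v.2 (f v j).2).2.2]
  · rw [h1, (hf v j).2.1]
  · rw [h2 v v.2, WGraph.nearestDist_eq (hinj v) j₀ (hmax v) (hout v j₀), ← (hf v j₀).2.1]

theorem rounds_work_le {n M ρ N : ℕ} (hρ : 1 ≤ ρ) (hρn : ρ ≤ n)
    (hN : N = n + M / ρ + 1 + n * ρ) :
    (ρ + 1) * (N + 1) ≤ 10 * (M + n * ρ ^ 2) ∧ M + 1 ≤ 10 * (M + n * ρ ^ 2) ∧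
      N + 1 ≤ 10 * (M + n * ρ ^ 2) := by
  have h5 : ρ * (M / ρ) ≤ M := Nat.mul_div_le M ρ
  have h8 : n ≤ n * ρ := Nat.le_mul_of_pos_right n hρ
  have h6 : n * ρ ≤ n * ρ ^ 2 := Nat.mul_le_mul_left n (Nat.le_self_pow (by decide) ρ)
  have h9 : M / ρ ≤ M := Nat.div_le_self M ρ
  have h10 : ρ * (N + 1) = n * ρ + ρ * (M / ρ) + 2 * ρ + n * ρ ^ 2 := by rw [hN]; ring
  have h11 : (ρ + 1) * (N + 1) = ρ * (N + 1) + (N + 1) := by ring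
  generalize n * ρ ^ 2 = x at *
  generalize n * ρ = y at *
  generalize ρ * (M / ρ) = z at *
  generalize M / ρ = u at *
  refine ⟨?_, ?_, ?_⟩ <;> omega

open PRAM in
/-- The program generates balls in `O(m + nρ²)` work and `O(ρ)` depth. -/
theorem ballProgram_exec {n : ℕ} (G : WGraph n) (A : G.AdjArrays) (ρ : ℕ)
    (hG : G.graph.Connected) (hρ : 1 ≤ ρ) (hρn : ρ ≤ n) :
    ∃ t w d, Exec ((n + 1) ^ 4) ballProgram (ballInput G A ρ) t w d ∧ GeneratesBalls G ρ t ∧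
      w ≤ ballProgram.size * (10 * (2 * G.numEdges + n * ρ ^ 2)) ∧
      d ≤ ballProgram.size * (2 * ρ) := by
  set M := 2 * G.numEdges with hM
  set B := (n + 1) ^ 4 with hBdef
  have hB : 4 * (n * n) + 8 * n + 4 ≤ B := by
    have : 4 ≤ (n + 1) ^ 2 := by nlinarith
    calc 4 * (n * n) + 8 * n + 4 = 4 * (n + 1) ^ 2 := by ring
      _ ≤ (n + 1) ^ 2 * (n + 1) ^ 2 := Nat.mul_le_mul_right _ this
      _ = B := by rw [hBdef]; ring
  have hMn : M ≤ n * n := WGraph.two_mul_numEdges_le A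
  have hnρ : n * ρ ≤ n * n := Nat.mul_le_mul_left n hρn
  set N := n + M / ρ + 1 + n * ρ with hNdef
  have hNn : n + n * ρ ≤ N := by
    rw [hNdef]
    have := Nat.zero_le (M / ρ)
    linarith
  have hin := WGraph.arcInput_ballInput A hρ
  obtain ⟨s₁, ⟨w₁, d₁, ex₁, hw₁, hd₁⟩, inv₁⟩ :=
    arcInit_runs (B := B) (N := M) hin (by omega) le_rfl
  obtain ⟨s₂, w₂, d₂, ex₂, inv₂, hw₂, hd₂⟩ := exec_loop (B := B) (N := N) (R := ρ)
    (b := .ilt (.read 0 (.const 3)) rhoE) (c := arcRound) (ArcInv n M ρ (ballInput G A ρ))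
    (fun k hk s hs => ⟨by
      simp only [BExpr.eval, IExpr.eval, hs.count, hs.other 2 (by decide), hin.ρ_eq, hk],
      arcRound_runs hin hk (by omega) le_rfl hs⟩)
    (fun s hs => by
      simp only [BExpr.eval, IExpr.eval, hs.count, hs.other 2 (by decide), hin.ρ_eq, lt_irrefl,
        not_false_iff]) (Nat.zero_le ρ) inv₁
  have hnet := WGraph.net_ballInput hG A hρ (inv₂.lightArcs hin)
  have hsin : SearchInput n ρ ((ballInput G A ρ).int 3) ((ballInput G A ρ).real 0) (s₂.int 5)
      s₂ :=
    { n_eq := by rw [inv₂.other 0 (by decide), hin.n_eq]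
      ρ_eq := by rw [inv₂.other 2 (by decide), hin.ρ_eq]
      ρ_pos := hρ
      ρ_le := hρn
      count := by rw [inv₂.other 4 (by decide), hin.count.2]
      head_eq := inv₂.agree.1 3 (by decide)
      list_eq := rfl
      w_eq := inv₂.agree.2 0 (by decide)
      zero := fun a ha => by
        rw [inv₂.agree.1 a (by
          simp only [List.mem_cons, List.not_mem_nil, or_false, not_or]; omega),
          hin.zero a (by omega)]
      rzero := by rw [inv₂.agree.2 5 (by decide), hin.rzero 5 (by decide)] }
  obtain ⟨s₃, ⟨w₃, d₃, ex₃, hw₃, hd₃⟩, inv₃⟩ :=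
    searchInit_runs (B := B) (N := N) (δ := G.natDist) hnet.self hsin (by omega) (by omega)
  obtain ⟨s₄, w₄, d₄, ex₄, inv₄, hw₄, hd₄⟩ := exec_loop (B := B) (N := N) (R := ρ)
    (b := .ilt (.read 0 (.const 4)) rhoE) (c := searchRound)
    (SearchMem n ρ ((ballInput G A ρ).int 3) ((ballInput G A ρ).real 0) (s₂.int 5) G.natDist s₂)
    (fun k hk s hs => ⟨by
      simp only [BExpr.eval, IExpr.eval, hs.count, hs.other 2 (by decide), hsin.ρ_eq, hk],
      searchRound_runs hnet hsin hk (by omega) hNn hs⟩)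
    (fun s hs => by
      simp only [BExpr.eval, IExpr.eval, hs.count, hs.other 2 (by decide), hsin.ρ_eq, lt_irrefl,
        not_false_iff]) (Nat.zero_le ρ) inv₃
  obtain ⟨t, ⟨w₅, d₅, ex₅, hw₅, hd₅⟩, h4, h1, h2⟩ := outCmd_runs (B := B) (N := N) (n := n)
    (ρ := ρ) s₄ (by rw [inv₄.other 0 (by decide), hsin.n_eq])
    (by rw [inv₄.other 2 (by decide), hsin.ρ_eq]) (by omega) hNn
  have ex : Exec B ballProgram (ballInput G A ρ) t _ _ :=
    .seq _ _ _ _ _ _ _ _ _ ex₁ (.seq _ _ _ _ _ _ _ _ _ ex₂ (.seq _ _ _ _ _ _ _ _ _ ex₃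
      (.seq _ _ _ _ _ _ _ _ _ ex₄ ex₅)))
  have hsize : ballProgram.size = arcInit.size + (arcLoop.size + (searchInit.size +
    (searchLoop.size + outCmd.size))) := rfl
  refine ⟨t, _, _, ex, generatesBalls_of_search hG hρ inv₄.inv h4 h1 h2, ?_, ?_⟩
  · obtain ⟨a1, a2, a3⟩ := rounds_work_le (M := M) hρ hρn hNdef
    have b2 : w₂ ≤ arcLoop.size * (10 * (M + n * ρ ^ 2)) := hw₂.trans (by
      rw [Nat.sub_zero, mul_left_comm]; exact Nat.mul_le_mul_left _ a1)
    have b4 : w₄ ≤ searchLoop.size * (10 * (M + n * ρ ^ 2)) := hw₄.trans (by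
      rw [Nat.sub_zero, mul_left_comm]; exact Nat.mul_le_mul_left _ a1)
    rw [hsize, add_mul, add_mul, add_mul, add_mul]
    exact add_le_add (hw₁.trans (Nat.mul_le_mul_left _ a2)) (add_le_add b2
      (add_le_add (hw₃.trans (Nat.mul_le_mul_left _ a3)) (add_le_add b4
        (hw₅.trans (Nat.mul_le_mul_left _ a3)))))
  · have a1 : 1 ≤ 2 * ρ := by omega
    have a2 : ρ - 0 + 1 ≤ 2 * ρ := by omega
    have b2 : d₂ ≤ arcLoop.size * (2 * ρ) := hd₂.trans (by
      rw [mul_comm]; exact Nat.mul_le_mul_left _ a2)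
    have b4 : d₄ ≤ searchLoop.size * (2 * ρ) := hd₄.trans (by
      rw [mul_comm]; exact Nat.mul_le_mul_left _ a2)
    rw [hsize, add_mul, add_mul, add_mul, add_mul]
    exact add_le_add (hd₁.trans (Nat.le_mul_of_pos_right _ a1)) (add_le_add b2
      (add_le_add (hd₃.trans (Nat.le_mul_of_pos_right _ a1)) (add_le_add b4
        (hd₅.trans (Nat.le_mul_of_pos_right _ a1)))))

theorem WGraph.numEdges_le_mul_log {n : ℕ} {G : WGraph n} (A : G.AdjArrays) :
    (G.numEdges : ℝ) ≤ 2 * (G.numEdges * Real.log n) := by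
  rcases Nat.eq_zero_or_pos G.numEdges with h | h
  · simp [h]
  · have hn : 2 ≤ n := by
      have h1 := WGraph.two_mul_numEdges_le A
      by_contra hc
      interval_cases n <;> omega
    have h1 : Real.log 2 ≤ Real.log n :=
      Real.log_le_log (by norm_num) (by exact_mod_cast hn)
    have h2 := Real.log_two_gt_d9
    have h3 : (0 : ℝ) ≤ G.numEdges := Nat.cast_nonneg _
    nlinarith

theorem one_le_two_mul_log {ρ : ℕ} (hρ : 1 ≤ ρ) : 1 ≤ 2 * Real.log (ρ + 1) := by
  have h0 : (1 : ℝ) ≤ ρ := by exact_mod_cast hρ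
  have h1 : Real.log 2 ≤ Real.log (ρ + 1) := Real.log_le_log (by norm_num) (by linarith)
  have h2 := Real.log_two_gt_d9
  linarith

/-- `(1,ρ)`-balls for all vertices can be generated in `O(m log n + n ρ²)` work and `O(ρ²)` depth,
and also in `O(m log n + n ρ² log ρ)` work and `O(ρ log ρ)` depth, where `log ρ` is replaced by
`log (ρ + 1)` to cover `ρ = 1`. -/
theorem mainTheorem6 :
    (∃ P : PRAM.Cmd, GeneratesBallsWithin P
      (fun n m ρ => m * Real.log n + n * (ρ : ℝ) ^ 2)
      (fun ρ => (ρ : ℝ) ^ 2)) ∧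
    (∃ P : PRAM.Cmd, GeneratesBallsWithin P
      (fun n m ρ => m * Real.log n + n * (ρ : ℝ) ^ 2 * Real.log (ρ + 1))
      (fun ρ => ρ * Real.log (ρ + 1))) := by
  have key : ∀ (n : ℕ) (G : WGraph n) (A : G.AdjArrays) (ρ : ℕ),
      G.graph.Connected → 1 ≤ ρ → ρ ≤ n → ∃ (t : PRAM.Memory) (w d : ℕ),
        PRAM.Exec ((n + 1) ^ 4) PRAM.ballProgram (ballInput G A ρ) t w d ∧
        GeneratesBalls G ρ t ∧
        (w : ℝ) ≤ (40 * PRAM.ballProgram.size) *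
          (G.numEdges * Real.log n + n * (ρ : ℝ) ^ 2) ∧
        (d : ℝ) ≤ (2 * PRAM.ballProgram.size) * ρ := by
    intro n G A ρ hG hρ hρn
    obtain ⟨t, w, d, h1, h2, h3, h4⟩ := ballProgram_exec G A ρ hG hρ hρn
    generalize PRAM.ballProgram.size = K at *
    refine ⟨t, w, d, h1, h2, ?_, ?_⟩
    · have h5 : (w : ℝ) ≤ K * (10 * (2 * G.numEdges + n * (ρ : ℝ) ^ 2)) := by exact_mod_cast h3
      refine h5.trans ?_
      rw [mul_comm (40 : ℝ), mul_assoc]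
      refine mul_le_mul_of_nonneg_left ?_ (Nat.cast_nonneg K)
      have h6 := WGraph.numEdges_le_mul_log A
      have h7 : (0 : ℝ) ≤ n * (ρ : ℝ) ^ 2 := by positivity
      linarith
    · have h5 : (d : ℝ) ≤ K * (2 * ρ) := by exact_mod_cast h4
      linarith
  refine ⟨⟨PRAM.ballProgram, 40 * PRAM.ballProgram.size, 4, fun n G A ρ hG hρ hρn => ?_⟩,
    ⟨PRAM.ballProgram, 80 * PRAM.ballProgram.size, 4, fun n G A ρ hG hρ hρn => ?_⟩⟩ <;>
  obtain ⟨t, w, d, h1, h2, h3, h4⟩ := key n G A ρ hG hρ hρn <;>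
  generalize PRAM.ballProgram.size = K at * <;>
  have hK : (0 : ℝ) ≤ K := Nat.cast_nonneg K <;>
  have hρ' : (1 : ℝ) ≤ ρ := by exact_mod_cast hρ
  · refine ⟨t, w, d, h1, h2, h3, h4.trans ?_⟩
    have h5 : (ρ : ℝ) ≤ (ρ : ℝ) ^ 2 := by nlinarith
    have h6 := mul_le_mul_of_nonneg_left h5 hK
    have h7 : 0 ≤ (K : ℝ) * (ρ : ℝ) ^ 2 := by positivity
    linarith
  · have hlog := one_le_two_mul_log hρ
    refine ⟨t, w, d, h1, h2, h3.trans ?_, h4.trans ?_⟩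
    · have h6 := WGraph.numEdges_le_mul_log A
      have h7 : (0 : ℝ) ≤ n * (ρ : ℝ) ^ 2 := by positivity
      have h8 : (0 : ℝ) ≤ G.numEdges := Nat.cast_nonneg _
      have h9 := mul_le_mul_of_nonneg_left hlog h7
      have h10 : G.numEdges * Real.log n + n * (ρ : ℝ) ^ 2 ≤
          2 * (G.numEdges * Real.log n + n * (ρ : ℝ) ^ 2 * Real.log (ρ + 1)) := by linarith
      calc _ ≤ _ := mul_le_mul_of_nonneg_left h10 (by positivity)
        _ = _ := by ring
    · have h5 : (ρ : ℝ) ≤ 2 * (ρ * Real.log (ρ + 1)) := by nlinarith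
      have h6 := mul_le_mul_of_nonneg_left h5 hK
      have h7 : 0 ≤ (K : ℝ) * (ρ * Real.log (ρ + 1)) := by
        have : 0 ≤ Real.log (ρ + 1) := by linarith
        positivity
      linarith
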